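/- Let $\zeta$ be the Riemann zeta function and let $c$ be Euler's constant (so $\ln 2\pi-2c\approx 0.68$). The function $t\mapsto \ln t-|\zeta(\tfrac12+it)|^2$ is integrable on $(0,T)$ for every $T>0$, and for every fixed $x>0$, $$\lim_{\tau\to\infty}\frac1\tau\int_0^{\frac{x\tau}{\ln 2\pi-2c}}\Bigl\{\ln t-\bigl|\zeta(\tfrac12+it)\bigr|^2\Bigr\}\,dt=x .$$ Equivalently, $$\int_0^T\Bigl\{\ln t-\bigl|\zeta(\tfrac12+it)\bigr|^2\Bigr\}\,dt\sim(\ln 2\pi-2c)\,T\qquad(T\to\infty).$$ -/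

import Mathlib

/-- The logarithmic modification of the Hardy-Littlewood integral,
`J₁(T) = ∫₀ᵀ (ln t - |ζ(1/2 + it)|²) dt`. -/
noncomputable def logHardyLittlewoodIntegral (T : ℝ) : ℝ :=
  ∫ t in (0 : ℝ)..T,
    (Real.log t - ‖riemannZeta (1 / 2 + (t : ℂ) * Complex.I)‖ ^ 2)

/-!
The claim is the mean value theorem `∫₀ᵀ |ζ(1/2 + it)|² dt = T log (T / 2π) + (2γ - 1) T + o(T)`,
rewritten: with the excess `F(t) = |ζ(1/2 + it)|² - log (t / 2π) - 2γ` it says `∫₀ᵀ F = o(T)`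
(`isLittleO_integral_zetaSqExcess`). The proof studies the Laplace transform of `F` at complex
points near the origin, in the manner of Hardy, Littlewood and Titchmarsh.

Let `K(z) = ∫ Γ(s) ζ(s)² z^{-s} dt` be the Mellin–Barnes integral over the critical line
`s = 1/2 + it`, for `re z > 0`. Replacing each factor `ζ(s)` by the limit of
`∑_{n ≤ N} n^{-s} - N^{1-s} / (1 - s)` expresses `K(z)` through the Lambert series
`∑ 1 / (e^{nz} - 1)` and an elementary function (`tendsto_sum_sub_integral_of_weight`,
`tendsto_sum_inv_exp_sub_one`). No contour is shifted. The Lambert series has period `2πi`, so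
`K(w + 2πi) - K(w)` is elementary (`zetaSqMellin_add_two_pi_I`), with main term
`2π (γ - log w) / w`, while `K(w)` itself is only `O(|w|^{-1/2} (|w| / re w)³)`
(`norm_zetaSqMellin_le`). On the other hand, the functional equation turns `K` at the point
`2πi e^{-iη}` into the Laplace transform `∫₀^∞ |ζ(1/2 + it)|² e^{-ηt} dt`, up to a bounded error
(`norm_laplace_zeta_sq_sub_le`). Together these show that the Laplace transform of `F` is
`O(δ^{-1/2} (|η| / δ)³)`, where `δ = re η` (`exists_norm_laplace_zeta_sq_sub_le`). Since
`F ≥ -log t`, it is moreover `O(δ^{-11/10})` uniformly in `im η`.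

Laplace inversion with the absolutely convergent kernel `e^{ηT} / η²` on the line `δ = 1 / T`
now bounds the second primitive `∫₀ᵀ (T - t) F(t) dt` by `O(T^{19/10})`
(`exists_abs_integral_sub_mul_zetaSqExcess_le`); taking differences with step `h = T^{19/20}` and
using `F ≥ -log t` again yields `∫₀ᵀ F = O(T^{39/40})`.
-/

section

open Complex Filter Topology MeasureTheory Set

/-! ### Approximation of zeta in the critical strip by partial sums -/

/-- The `N`-th Euler–Maclaurin approximation `∑_{n ≤ N} n^{-s} - N^{1-s} / (1 - s)` to `ζ(s)`. -/
noncomputable def zetaApprox (N : ℕ) (s : ℂ) : ℂ :=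
  ∑ n ∈ Finset.Icc 1 N, (n : ℂ) ^ (-s) - (N : ℂ) ^ (1 - s) / (1 - s)

/-- One step of the Euler–Maclaurin approximation, bounded by a telescoping quantity. Both sides
extend to functions of a real endpoint in `[m, m + 1]` that vanish at `m`, and the derivatives are
compared. -/
theorem norm_zetaApprox_succ_sub_le {m : ℕ} (hm : 1 ≤ m) {s : ℂ} (hs : 0 < s.re) (hs1 : s ≠ 1) :
    ‖zetaApprox (m + 1) s - zetaApprox m s‖ ≤
      ‖s‖ / s.re * ((m : ℝ) ^ (-s.re) - ((m + 1 : ℕ) : ℝ) ^ (-s.re)) := by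
  have hm0 : (0 : ℝ) < m := by exact_mod_cast hm
  have hs0 : -s ≠ 0 := by
    intro h
    have : s = 0 := by simpa using h
    simp [this] at hs
  have h1s : 1 - s ≠ 0 := sub_ne_zero.mpr (Ne.symm hs1)
  set φ : ℝ → ℂ := fun x => ((x : ℂ) - m) * (x : ℂ) ^ (-s) -
    ((x : ℂ) ^ (1 - s) - (m : ℂ) ^ (1 - s)) / (1 - s) with hφ
  have hder : ∀ x : ℝ, 0 < x →
      HasDerivAt φ (((x : ℂ) - m) * (-s * (x : ℂ) ^ (-s - 1))) x := by
    intro x hx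
    have h1 := hasDerivAt_ofReal_cpow_const hx.ne' hs0
    have h2 := hasDerivAt_ofReal_cpow_const hx.ne' h1s
    have h3 : HasDerivAt (fun y : ℝ => (y : ℂ) - m) 1 x :=
      (hasDerivAt_id x).ofReal_comp.sub_const _
    have h4 := (h3.mul h1).sub ((h2.sub_const ((m : ℂ) ^ (1 - s))).div_const (1 - s))
    refine h4.congr_deriv ?_
    have : (1 : ℂ) - s - 1 = -s := by ring
    rw [this]
    field_simp
    ring
  have hBder : ∀ x : ℝ, 0 < x → HasDerivAt
      (fun x : ℝ => ‖s‖ / s.re * ((m : ℝ) ^ (-s.re) - x ^ (-s.re))) (‖s‖ * x ^ (-s.re - 1)) x := by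
    intro x hx
    have := ((Real.hasDerivAt_rpow_const (x := x) (p := -s.re) (Or.inl hx.ne')).const_sub
      ((m : ℝ) ^ (-s.re))).const_mul (‖s‖ / s.re)
    refine this.congr_deriv ?_
    field_simp
  have key := image_norm_le_of_norm_deriv_right_le_deriv_boundary' (f := φ)
    (f' := fun x => ((x : ℂ) - m) * (-s * (x : ℂ) ^ (-s - 1))) (a := (m : ℝ)) (b := (m : ℝ) + 1)
    (fun x hx => (hder x (hm0.trans_le hx.1)).continuousAt.continuousWithinAt)
    (fun x hx => (hder x (hm0.trans_le hx.1)).hasDerivWithinAt)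
    (B := fun x : ℝ => ‖s‖ / s.re * ((m : ℝ) ^ (-s.re) - x ^ (-s.re)))
    (B' := fun x => ‖s‖ * x ^ (-s.re - 1))
    (by simp [hφ])
    (fun x hx => (hBder x (hm0.trans_le hx.1)).continuousAt.continuousWithinAt)
    (fun x hx => (hBder x (hm0.trans_le hx.1)).hasDerivWithinAt)
    (by
      intro x hx
      have hx0 := hm0.trans_le hx.1
      rw [norm_mul, norm_mul, norm_neg, norm_cpow_eq_rpow_re_of_pos hx0]
      have h1 : ‖(x : ℂ) - m‖ ≤ 1 := by
        rw [← ofReal_natCast, ← ofReal_sub, norm_real, Real.norm_eq_abs, abs_le]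
        constructor <;> linarith [hx.1, hx.2]
      have h2 : (-s - 1).re = -s.re - 1 := by simp
      rw [h2]
      exact mul_le_of_le_one_left (by positivity) h1)
    (x := (m : ℝ) + 1) ⟨by linarith, le_rfl⟩
  have heq : zetaApprox (m + 1) s - zetaApprox m s = φ ((m : ℝ) + 1) := by
    rw [zetaApprox, zetaApprox, Finset.sum_Icc_succ_top (by omega), hφ]
    push_cast
    ring
  rw [heq]
  simpa using key

theorem norm_zetaApprox_sub_le {N M : ℕ} (hN : 1 ≤ N) (hNM : N ≤ M) {s : ℂ} (hs : 0 < s.re)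
    (hs1 : s ≠ 1) :
    ‖zetaApprox M s - zetaApprox N s‖ ≤
      ‖s‖ / s.re * ((N : ℝ) ^ (-s.re) - (M : ℝ) ^ (-s.re)) := by
  induction M, hNM using Nat.le_induction with
  | base => simp
  | succ M hM ih =>
    have h := norm_zetaApprox_succ_sub_le (hN.trans hM) hs hs1
    calc ‖zetaApprox (M + 1) s - zetaApprox N s‖
        = ‖(zetaApprox (M + 1) s - zetaApprox M s) + (zetaApprox M s - zetaApprox N s)‖ := by
          ring_nf
      _ ≤ _ := norm_add_le _ _
      _ ≤ _ := add_le_add h ih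
      _ = _ := by ring

theorem tendsto_zetaApprox_of_one_lt {s : ℂ} (hs : 1 < s.re) :
    Tendsto (fun N => zetaApprox N s) atTop (𝓝 (riemannZeta s)) := by
  have hsum : HasSum (fun n : ℕ => 1 / ((n : ℂ) + 1) ^ s) (riemannZeta s) := by
    rw [zeta_eq_tsum_one_div_nat_add_one_cpow hs]
    refine Summable.hasSum ?_
    have := (Complex.summable_one_div_nat_cpow (p := s)).mpr hs
    simpa using (summable_nat_add_iff 1).mpr this
  have h1 : Tendsto (fun N : ℕ => ∑ n ∈ Finset.Icc 1 N, (n : ℂ) ^ (-s)) atTop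
      (𝓝 (riemannZeta s)) := by
    refine hsum.tendsto_sum_nat.congr fun N => ?_
    induction N with
    | zero => simp
    | succ N ih =>
      rw [Finset.sum_range_succ, ih, Finset.sum_Icc_succ_top (by omega), cpow_neg]
      push_cast
      rw [one_div]
  have h2 : Tendsto (fun N : ℕ => (N : ℂ) ^ (1 - s) / (1 - s)) atTop (𝓝 0) := by
    have h3 : Tendsto (fun N : ℕ => (N : ℂ) ^ (1 - s)) atTop (𝓝 0) := by
      rw [tendsto_zero_iff_norm_tendsto_zero]
      have h4 : Tendsto (fun N : ℕ => (N : ℝ) ^ (-(s.re - 1))) atTop (𝓝 0) :=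
        (tendsto_rpow_neg_atTop (by linarith)).comp tendsto_natCast_atTop_atTop
      refine h4.congr' ?_
      filter_upwards [eventually_ge_atTop 1] with N hN
      rw [norm_natCast_cpow_of_pos (by omega)]
      congr 1
      simp
    simpa using h3.div_const (1 - s)
  simpa [zetaApprox] using h1.sub h2

/-- The values `(s - 1) * zetaApprox N s` with the removable singularity at `s = 1` filled in. -/
noncomputable def zetaApproxMul (N : ℕ) (s : ℂ) : ℂ :=
  (s - 1) * ∑ n ∈ Finset.Icc 1 N, (n : ℂ) ^ (-s) + (N : ℂ) ^ (1 - s)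

theorem zetaApproxMul_eq (N : ℕ) {s : ℂ} (hs1 : s ≠ 1) :
    zetaApproxMul N s = (s - 1) * zetaApprox N s := by
  have h1s : 1 - s ≠ 0 := sub_ne_zero.mpr (Ne.symm hs1)
  rw [zetaApproxMul, zetaApprox]
  field_simp
  ring

theorem differentiable_zetaApproxMul {N : ℕ} (hN : 1 ≤ N) :
    Differentiable ℂ (zetaApproxMul N) := by
  have h : ∀ n : ℕ, 1 ≤ n → (n : ℂ) ≠ 0 := fun n hn => by exact_mod_cast (by omega : n ≠ 0)
  unfold zetaApproxMul
  refine ((differentiable_id.sub_const 1).mul (Differentiable.fun_sum fun n hn => ?_)).add ?_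
  · intro s
    exact (differentiableAt_id.neg).const_cpow (Or.inl (h n (Finset.mem_Icc.mp hn).1))
  · intro s
    exact (differentiableAt_id.const_sub 1).const_cpow (Or.inl (h N hN))

theorem rpow_neg_sub_rpow_neg_le {m : ℕ} (hm : 1 ≤ m) {σ : ℝ} (hσ : 0 < σ) :
    (m : ℝ) ^ (-σ) - ((m + 1 : ℕ) : ℝ) ^ (-σ) ≤ σ * (m : ℝ) ^ (-σ - 1) := by
  have hm0 : (0 : ℝ) < m := by exact_mod_cast hm
  have h1 : ((m + 1 : ℕ) : ℝ) = m * (1 + 1 / m) := by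
    push_cast
    field_simp
  have h2 : 1 - σ * (1 / m) ≤ (1 + 1 / (m : ℝ)) ^ (-σ) := by
    rw [Real.rpow_def_of_pos (by positivity)]
    have h3 := Real.log_le_sub_one_of_pos (x := 1 + 1 / (m : ℝ)) (by positivity)
    have h4 := Real.add_one_le_exp (Real.log (1 + 1 / (m : ℝ)) * -σ)
    nlinarith
  rw [h1, Real.mul_rpow hm0.le (by positivity), Real.rpow_sub hm0, Real.rpow_one]
  have h5 : 0 < (m : ℝ) ^ (-σ) := Real.rpow_pos_of_pos hm0 _
  have h6 : σ * ((m : ℝ) ^ (-σ) / m) = (m : ℝ) ^ (-σ) * (σ * (1 / m)) := by ring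
  rw [h6]
  nlinarith

theorem norm_zetaApproxMul_succ_sub_le {m : ℕ} (hm : 1 ≤ m) {s : ℂ} (hs : 0 < s.re) :
    ‖zetaApproxMul (m + 1) s - zetaApproxMul m s‖ ≤ ‖s - 1‖ * ‖s‖ * (m : ℝ) ^ (-s.re - 1) := by
  by_cases hs1 : s = 1
  · subst hs1
    simp [zetaApproxMul]
  · rw [zetaApproxMul_eq _ hs1, zetaApproxMul_eq _ hs1, ← mul_sub, norm_mul, mul_assoc]
    refine mul_le_mul_of_nonneg_left ?_ (norm_nonneg _)
    refine (norm_zetaApprox_succ_sub_le hm hs hs1).trans ?_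
    have := rpow_neg_sub_rpow_neg_le hm hs
    calc _ ≤ ‖s‖ / s.re * (s.re * (m : ℝ) ^ (-s.re - 1)) := by gcongr
      _ = _ := by field_simp

/-- The approximations `zetaApprox N s` converge to `ζ(s)` in the whole half-plane `0 < re s`:
`(s - 1) * zetaApprox N s` converges locally uniformly there, and its limit is `(s - 1) ζ(s)` for
`1 < re s`. -/
theorem tendsto_zetaApprox {s : ℂ} (hs : 0 < s.re) (hs1 : s ≠ 1) :
    Tendsto (fun N => zetaApprox N s) atTop (𝓝 (riemannZeta s)) := by
  set σ := s.re / 2 with hσ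
  have hσ0 : 0 < σ := by positivity
  set R := ‖s‖ + σ + 3 with hR
  set U : Set ℂ := {z | σ < z.re} ∩ Metric.ball 0 R with hU
  have hUo : IsOpen U := (isOpen_lt continuous_const continuous_re).inter Metric.isOpen_ball
  have hUc : Convex ℝ U := (convex_halfSpace_re_gt σ).inter (convex_ball 0 R)
  set F : ℕ → ℂ → ℂ := fun n z => zetaApproxMul (n + 1 + 1) z - zetaApproxMul (n + 1) z with hF
  set u : ℕ → ℝ := fun n => (R + 1) * R * ((n + 1 : ℕ) : ℝ) ^ (-σ - 1) with hu
  have husum : Summable u := by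
    have h1 : Summable (fun n : ℕ => (n : ℝ) ^ (-σ - 1)) :=
      Real.summable_nat_rpow.mpr (by linarith)
    exact ((summable_nat_add_iff 1).mpr h1).mul_left _
  have hFu : ∀ n, ∀ z ∈ U, ‖F n z‖ ≤ u n := by
    intro n z hz
    have hz1 : σ < z.re := hz.1
    have hz2 : ‖z‖ < R := by simpa using hz.2
    refine (norm_zetaApproxMul_succ_sub_le (by omega) (hσ0.trans hz1)).trans ?_
    have h1 : ‖z - 1‖ ≤ R + 1 := (norm_sub_le _ _).trans (by simpa using hz2.le)
    have h2 : ((n + 1 : ℕ) : ℝ) ^ (-z.re - 1) ≤ ((n + 1 : ℕ) : ℝ) ^ (-σ - 1) :=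
      Real.rpow_le_rpow_of_exponent_le (by norm_cast; omega) (by linarith)
    have hR0 : 0 < R := (norm_nonneg z).trans_lt hz2
    simp only [hu]
    gcongr
  have hdiff : DifferentiableOn ℂ (fun z => ∑' n, F n z) U :=
    differentiableOn_tsum_of_summable_norm husum
      (fun n => ((differentiable_zetaApproxMul (by omega)).sub
        (differentiable_zetaApproxMul (by omega))).differentiableOn) hUo hFu
  have hlim : ∀ z ∈ U, Tendsto (fun N => zetaApproxMul (N + 1) z) atTop
      (𝓝 (zetaApproxMul 1 z + ∑' n, F n z)) := by
    intro z hz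
    have hs : Summable (fun n => F n z) := husum.of_norm_bounded (fun n => hFu n z hz)
    have := (hs.hasSum.tendsto_sum_nat).const_add (zetaApproxMul 1 z)
    refine this.congr fun N => ?_
    simp only [hF]
    rw [Finset.sum_range_sub (fun n => zetaApproxMul (n + 1) z)]
    simp
  have heq : Set.EqOn (fun z => zetaApproxMul 1 z + ∑' n, F n z) riemannZeta₁ U := by
    have h2U : (2 : ℂ) + σ ∈ U := by
      refine ⟨by simp, ?_⟩
      simp only [Metric.mem_ball, dist_zero_right]
      refine (norm_add_le _ _).trans_lt ?_
      rw [norm_real, Real.norm_of_nonneg hσ0.le]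
      have := norm_nonneg s
      simp only [norm_ofNat]
      linarith
    refine AnalyticOnNhd.eqOn_of_preconnected_of_eventuallyEq
      ((((differentiable_zetaApproxMul le_rfl).differentiableOn).add hdiff).analyticOnNhd hUo)
      (differentiable_riemannZeta₁.differentiableOn.analyticOnNhd hUo) hUc.isPreconnected h2U ?_
    have hopen : {z : ℂ | 1 < z.re} ∈ 𝓝 ((2 : ℂ) + σ) :=
      (isOpen_lt continuous_const continuous_re).mem_nhds (by simp; linarith)
    filter_upwards [hopen, hUo.mem_nhds h2U] with z hz hzU
    have hz1 : z ≠ 1 := by rintro rfl; simp at hz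
    have h1 := (tendsto_zetaApprox_of_one_lt hz).const_mul (z - 1)
    have h2 := h1.comp (tendsto_add_atTop_nat 1)
    have h3 := tendsto_nhds_unique (hlim z hzU)
      (h2.congr fun N => (zetaApproxMul_eq (N + 1) hz1).symm)
    rw [h3, riemannZeta_eq_inv_sub_mul hz1]
    have : z - 1 ≠ 0 := sub_ne_zero.mpr hz1
    field_simp
  have hsU : s ∈ U := ⟨by simp [hσ]; linarith, by simp [hR]; linarith⟩
  have h1 := hlim s hsU
  have h2 : zetaApproxMul 1 s + ∑' n, F n s = riemannZeta₁ s := heq hsU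
  have h1s : s - 1 ≠ 0 := sub_ne_zero.mpr hs1
  rw [h2] at h1
  rw [← tendsto_add_atTop_iff_nat 1]
  have h3 := h1.const_mul ((s - 1)⁻¹)
  rw [← riemannZeta_eq_inv_sub_mul hs1] at h3
  refine h3.congr fun N => ?_
  rw [zetaApproxMul_eq _ hs1]
  field_simp

theorem norm_riemannZeta_sub_zetaApprox_le {N : ℕ} (hN : 1 ≤ N) {s : ℂ} (hs : 0 < s.re)
    (hs1 : s ≠ 1) :
    ‖riemannZeta s - zetaApprox N s‖ ≤ ‖s‖ / s.re * (N : ℝ) ^ (-s.re) := by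
  refine le_of_tendsto ((tendsto_zetaApprox hs hs1).sub_const (zetaApprox N s)).norm ?_
  filter_upwards [eventually_ge_atTop N] with M hM
  refine (norm_zetaApprox_sub_le hN hM hs hs1).trans ?_
  gcongr
  linarith [Real.rpow_nonneg (Nat.cast_nonneg (α := ℝ) M) (-s.re)]

/-- The point `1 / 2 + i t` of the critical line. -/
noncomputable def criticalPoint (t : ℝ) : ℂ := 1 / 2 + (t : ℂ) * I

@[simp] theorem criticalPoint_re (t : ℝ) : (criticalPoint t).re = 1 / 2 := by
  simp [criticalPoint]

@[simp] theorem criticalPoint_im (t : ℝ) : (criticalPoint t).im = t := by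
  simp [criticalPoint]

theorem criticalPoint_ne_one (t : ℝ) : criticalPoint t ≠ 1 := by
  intro h
  have := congrArg Complex.re h
  norm_num at this

theorem continuous_criticalPoint : Continuous criticalPoint := by
  unfold criticalPoint
  fun_prop

theorem continuous_riemannZeta_criticalPoint :
    Continuous fun t => riemannZeta (criticalPoint t) := by
  refine continuous_iff_continuousAt.mpr fun t => ?_
  exact (differentiableAt_riemannZeta (criticalPoint_ne_one t)).continuousAt.comp
    continuous_criticalPoint.continuousAt

theorem norm_criticalPoint_le (t : ℝ) : ‖criticalPoint t‖ ≤ 1 + |t| := by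
  refine (norm_le_abs_re_add_abs_im _).trans ?_
  rw [criticalPoint_re, criticalPoint_im, abs_of_pos (by norm_num : (0 : ℝ) < 1 / 2)]
  linarith

/-- A crude bound for zeta on the critical line: only polynomial growth matters, as the
gamma factor decays exponentially. -/
theorem norm_riemannZeta_criticalPoint_le (t : ℝ) :
    ‖riemannZeta (criticalPoint t)‖ ≤ 5 * (1 + |t|) := by
  have h1 := norm_riemannZeta_sub_zetaApprox_le le_rfl (s := criticalPoint t) (by norm_num)
    (criticalPoint_ne_one t)
  have h2 := norm_criticalPoint_le t
  have h3 : 1 / 2 ≤ ‖1 - criticalPoint t‖ := by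
    refine le_trans ?_ (abs_re_le_norm _)
    norm_num
  have h4 : ‖zetaApprox 1 (criticalPoint t)‖ ≤ 3 := by
    have : zetaApprox 1 (criticalPoint t) = 1 - 1 / (1 - criticalPoint t) := by simp [zetaApprox]
    rw [this]
    refine (norm_sub_le _ _).trans ?_
    rw [norm_div, norm_one]
    have : 1 / ‖1 - criticalPoint t‖ ≤ 1 / (1 / 2) := one_div_le_one_div_of_le (by norm_num) h3
    linarith
  have h5 : ‖riemannZeta (criticalPoint t)‖ ≤ ‖riemannZeta (criticalPoint t) -
      zetaApprox 1 (criticalPoint t)‖ + ‖zetaApprox 1 (criticalPoint t)‖ := by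
    simpa using norm_add_le (riemannZeta (criticalPoint t) - zetaApprox 1 (criticalPoint t))
      (zetaApprox 1 (criticalPoint t))
  simp only [criticalPoint_re, Nat.cast_one, Real.one_rpow] at h1
  have := abs_nonneg t
  linarith

/-- The bound is uniform in `N`, as needed for dominated convergence. -/
theorem norm_zetaApprox_criticalPoint_le {N : ℕ} (hN : 1 ≤ N) (t : ℝ) :
    ‖zetaApprox N (criticalPoint t)‖ ≤ 7 * (1 + |t|) := by
  have h1 := norm_riemannZeta_sub_zetaApprox_le hN (s := criticalPoint t) (by norm_num)
    (criticalPoint_ne_one t)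
  have h2 := norm_criticalPoint_le t
  have h3 : (N : ℝ) ^ (-(1 / 2 : ℝ)) ≤ 1 :=
    Real.rpow_le_one_of_one_le_of_nonpos (by exact_mod_cast hN) (by norm_num)
  rw [criticalPoint_re] at h1
  have h4 : ‖criticalPoint t‖ / (1 / 2) * (N : ℝ) ^ (-(1 / 2 : ℝ)) ≤ ‖criticalPoint t‖ / (1 / 2) :=
    mul_le_of_le_one_right (by positivity) h3
  have h5 : ‖zetaApprox N (criticalPoint t)‖ ≤ ‖riemannZeta (criticalPoint t)‖ +
      ‖riemannZeta (criticalPoint t) - zetaApprox N (criticalPoint t)‖ := by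
    simpa using norm_sub_le (riemannZeta (criticalPoint t))
      (riemannZeta (criticalPoint t) - zetaApprox N (criticalPoint t))
  have h6 := norm_riemannZeta_criticalPoint_le t
  linarith

/-! ### Euler's integral and Mellin–Barnes integrals on the critical line -/

/-- Differentiation of Euler's integral in its scaling parameter. -/
theorem hasDerivAt_integral_cpow_mul_exp {a : ℂ} (ha : 0 < a.re) {r : ℂ} (hr : 0 < r.re) :
    HasDerivAt (fun r : ℂ => ∫ x in Ioi (0 : ℝ), (x : ℂ) ^ (a - 1) * cexp (-(r * x)))
      (∫ x in Ioi (0 : ℝ), (x : ℂ) ^ (a - 1) * (cexp (-(r * x)) * -x)) r := by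
  have hcont : ∀ r : ℂ, ContinuousOn (fun x : ℝ => (x : ℂ) ^ (a - 1) * cexp (-(r * x)))
      (Ioi 0) := by
    intro r
    refine ContinuousOn.mul ?_ (by fun_prop)
    exact fun x hx => (continuousAt_ofReal_cpow_const _ _ (Or.inr (ne_of_gt hx))).continuousWithinAt
  have hnorm : ∀ (r : ℂ) (x : ℝ), 0 < x →
      ‖(x : ℂ) ^ (a - 1) * cexp (-(r * x))‖ = x ^ (a.re - 1) * Real.exp (-r.re * x) := by
    intro r x hx
    rw [norm_mul, norm_cpow_eq_rpow_re_of_pos hx, norm_exp]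
    simp
  have hint : ∀ {p b : ℝ}, -1 < p → 0 < b →
      IntegrableOn (fun x : ℝ => x ^ p * Real.exp (-b * x)) (Ioi 0) := by
    intro p b hp hb
    simpa using integrableOn_rpow_mul_exp_neg_mul_rpow hp (zero_lt_one) hb
  refine (hasDerivAt_integral_of_dominated_loc_of_deriv_le
    (F := fun (r : ℂ) (x : ℝ) => (x : ℂ) ^ (a - 1) * cexp (-(r * x)))
    (F' := fun (r : ℂ) (x : ℝ) => (x : ℂ) ^ (a - 1) * (cexp (-(r * x)) * -x))
    (s := {w : ℂ | r.re / 2 < w.re})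
    (bound := fun x => x ^ a.re * Real.exp (-(r.re / 2) * x))
    ((isOpen_lt continuous_const continuous_re).mem_nhds (by simpa using by linarith))
    (Eventually.of_forall fun r => (hcont r).aestronglyMeasurable measurableSet_Ioi) ?_ ?_ ?_
    (hint (by linarith) (by linarith)) ?_).2
  · refine (hint (p := a.re - 1) (by linarith) hr).mono'
      ((hcont r).aestronglyMeasurable measurableSet_Ioi) ?_
    exact (ae_restrict_mem measurableSet_Ioi).mono fun x hx => (hnorm r x hx).le
  · refine ContinuousOn.aestronglyMeasurable ?_ measurableSet_Ioi
    have : ContinuousOn (fun x : ℝ => -(x : ℂ)) (Ioi 0) := by fun_prop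
    refine ((hcont r).mul this).congr fun x _ => ?_
    simp [mul_assoc]
  · refine (ae_restrict_mem measurableSet_Ioi).mono fun x hx w hw => ?_
    have hx0 : (0 : ℝ) < x := hx
    rw [← mul_assoc, norm_mul, hnorm w x hx, norm_neg, norm_real, Real.norm_of_nonneg hx0.le,
      Real.rpow_sub_one hx0.ne']
    have hw' : r.re / 2 < w.re := hw
    have h1 : Real.exp (-w.re * x) ≤ Real.exp (-(r.re / 2) * x) :=
      Real.exp_le_exp.mpr (by nlinarith)
    have h2 : x ^ a.re / x * Real.exp (-w.re * x) * x = x ^ a.re * Real.exp (-w.re * x) := by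
      field_simp
    rw [h2]
    gcongr
  · refine Eventually.of_forall fun x w _ => ?_
    have h1 : HasDerivAt (fun w : ℂ => -(w * x)) (-x) w := by
      exact ((hasDerivAt_id w).mul_const (x : ℂ)).neg.congr_deriv (by simp)
    exact (h1.cexp).const_mul _

/-- Euler's integral with a complex scaling parameter, obtained from real parameters by analytic
continuation. -/
theorem integral_cpow_mul_exp_neg_complex_mul {a : ℂ} (ha : 0 < a.re) {r : ℂ} (hr : 0 < r.re) :
    ∫ x in Ioi (0 : ℝ), (x : ℂ) ^ (a - 1) * cexp (-(r * x)) = r ^ (-a) * Gamma a := by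
  set U : Set ℂ := {w | 0 < w.re} with hU
  have hUo : IsOpen U := isOpen_lt continuous_const continuous_re
  have h0 : ∀ w ∈ U, w ∈ slitPlane := fun w hw => Or.inl hw
  have hEq : EqOn (fun r : ℂ => ∫ x in Ioi (0 : ℝ), (x : ℂ) ^ (a - 1) * cexp (-(r * x)))
      (fun r => r ^ (-a) * Gamma a) U := by
    refine AnalyticOnNhd.eqOn_of_preconnected_of_frequently_eq (z₀ := 1) ?_ ?_
      (convex_halfSpace_re_gt 0).isPreconnected (by simp [hU]) ?_
    · refine DifferentiableOn.analyticOnNhd (fun w hw => ?_) hUo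
      exact (hasDerivAt_integral_cpow_mul_exp ha hw).differentiableAt.differentiableWithinAt
    · refine DifferentiableOn.analyticOnNhd (fun w hw => ?_) hUo
      exact ((differentiableAt_id.cpow_const (h0 w hw)).mul_const _).differentiableWithinAt
    · have h1 : Tendsto (fun n : ℕ => ((1 + 1 / ((n : ℝ) + 1) : ℝ) : ℂ)) atTop (𝓝[≠] 1) := by
        refine tendsto_nhdsWithin_iff.mpr ⟨?_, Eventually.of_forall fun n => ?_⟩
        · have := (tendsto_one_div_add_atTop_nhds_zero_nat (𝕜 := ℝ)).const_add 1
          rw [add_zero] at this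
          exact (continuous_ofReal.tendsto 1).comp this |>.trans (by simp)
        · have : (0 : ℝ) < 1 / ((n : ℝ) + 1) := by positivity
          intro h
          have h2 : (1 + 1 / ((n : ℝ) + 1) : ℝ) = 1 := ofReal_eq_one.mp h
          linarith
      refine h1.frequently (Eventually.of_forall fun n => ?_).frequently
      have hp : (0 : ℝ) < 1 + 1 / ((n : ℝ) + 1) := by positivity
      have h2 := Complex.integral_cpow_mul_exp_neg_mul_Ioi ha hp
      refine h2.trans ?_
      rw [one_div, inv_cpow _ _ (by rw [arg_ofReal_of_nonneg hp.le]; exact Real.pi_pos.ne),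
        ← cpow_neg]
  exact hEq hr

/-- Euler's reflection formula on the critical line, where `1 - s` is the conjugate of `s`. -/
theorem norm_sq_Gamma_criticalPoint (t : ℝ) :
    ‖Gamma (criticalPoint t)‖ ^ 2 = Real.pi / Real.cosh (Real.pi * t) := by
  have h1 : (1 : ℂ) - criticalPoint t = (starRingEnd ℂ) (criticalPoint t) := by
    apply Complex.ext <;> simp
    norm_num
  have h2 := Complex.Gamma_mul_Gamma_one_sub (criticalPoint t)
  rw [h1, Complex.Gamma_conj, mul_conj, normSq_eq_norm_sq] at h2
  have h3 : sin (Real.pi * criticalPoint t) = (Real.cosh (Real.pi * t) : ℂ) := by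
    have : (Real.pi : ℂ) * criticalPoint t = ((Real.pi * t : ℝ) : ℂ) * I + Real.pi / 2 := by
      rw [criticalPoint]; push_cast; ring
    rw [this, Complex.sin_add_pi_div_two, Complex.cos_mul_I, ofReal_cosh]
  rw [h3] at h2
  exact_mod_cast h2

theorem norm_Gamma_criticalPoint_le (t : ℝ) :
    ‖Gamma (criticalPoint t)‖ ≤ 3 * Real.exp (-(Real.pi / 2 * |t|)) := by
  refine abs_le_of_sq_le_sq' ?_ (by positivity) |>.2
  rw [norm_sq_Gamma_criticalPoint, mul_pow, ← Real.exp_nat_mul, div_le_iff₀ (Real.cosh_pos _)]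
  have h1 : Real.exp (Real.pi * |t|) / 2 ≤ Real.cosh (Real.pi * t) := by
    rw [← Real.cosh_abs, abs_mul, abs_of_pos Real.pi_pos, Real.cosh_eq]
    have := Real.exp_pos (-(Real.pi * |t|))
    linarith
  have h2 : Real.exp ((2 : ℕ) * -(Real.pi / 2 * |t|)) * Real.exp (Real.pi * |t|) = 1 := by
    rw [← Real.exp_add, Real.exp_eq_one_iff]
    push_cast
    ring
  have h3 := Real.pi_le_four
  have h4 := Real.exp_pos ((2 : ℕ) * -(Real.pi / 2 * |t|))
  nlinarith [mul_le_mul_of_nonneg_left h1 h4.le]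

theorem continuous_Gamma_criticalPoint : Continuous fun t => Gamma (criticalPoint t) := by
  refine continuous_iff_continuousAt.mpr fun t => ?_
  refine (differentiableAt_Gamma _ fun m h => ?_).continuousAt.comp
    continuous_criticalPoint.continuousAt
  have := congrArg Complex.re h
  simp only [criticalPoint_re, neg_re, natCast_re] at this
  have h2 : (0 : ℝ) ≤ m := Nat.cast_nonneg m
  linarith

theorem integrable_exp_neg_mul_abs {a : ℝ} (ha : 0 < a) :
    Integrable fun t : ℝ => Real.exp (-(a * |t|)) := by
  rw [← integrableOn_univ, ← Iic_union_Ioi (a := (0 : ℝ)), integrableOn_union]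
  constructor
  · refine (integrableOn_exp_mul_Iic ha 0).congr_fun (fun t ht => ?_) measurableSet_Iic
    simp [abs_of_nonpos (show t ≤ 0 from ht)]
  · refine (integrableOn_exp_mul_Ioi (neg_lt_zero.mpr ha) 0).congr_fun (fun t ht => ?_)
      measurableSet_Ioi
    simp [abs_of_pos (show 0 < t from ht)]

theorem integral_exp_neg_mul_abs {a : ℝ} (ha : 0 < a) :
    ∫ t : ℝ, Real.exp (-(a * |t|)) = 2 / a := by
  rw [integral_comp_abs (f := fun t => Real.exp (-(a * t)))]
  have := integral_exp_mul_Ioi (neg_lt_zero.mpr ha) 0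
  simp only [mul_zero, Real.exp_zero, neg_mul] at this
  rw [this]
  field_simp

theorem one_add_abs_sq_mul_exp_le {a : ℝ} (ha : 0 < a) (ha1 : a ≤ 4) (t : ℝ) :
    (1 + |t|) ^ 2 * Real.exp (-(a * |t|)) ≤ 16 / a ^ 2 * Real.exp (-(a / 2 * |t|)) := by
  have h0 := abs_nonneg t
  have h1 : 1 + |t| ≤ 4 / a * Real.exp (a / 4 * |t|) := by
    have h2 := Real.add_one_le_exp (a / 4 * |t|)
    have h3 : 4 / a * (a / 4 * |t| + 1) = |t| + 4 / a := by field_simp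
    have h4 : 1 ≤ 4 / a := by rw [le_div_iff₀ ha]; linarith
    have h5 : 4 / a * (a / 4 * |t| + 1) ≤ 4 / a * Real.exp (a / 4 * |t|) := by gcongr
    linarith
  have h6 : (1 + |t|) ^ 2 ≤ (4 / a * Real.exp (a / 4 * |t|)) ^ 2 := by gcongr
  calc (1 + |t|) ^ 2 * Real.exp (-(a * |t|))
      ≤ (4 / a * Real.exp (a / 4 * |t|)) ^ 2 * Real.exp (-(a * |t|)) := by gcongr
    _ = 16 / a ^ 2 * (Real.exp (a / 4 * |t|) ^ 2 * Real.exp (-(a * |t|))) := by ring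
    _ = _ := by
      rw [← Real.exp_nat_mul, ← Real.exp_add]
      congr 2
      push_cast
      ring

/-- The exponential growth of `z ^ (-s)` on the critical line falls short of that of
`exp (π |t| / 2)` by the angle between `z` and the imaginary axis, which is at least `re z / ‖z‖`. -/
theorem norm_cpow_criticalPoint_le {z : ℂ} (hz : 0 < z.re) (t : ℝ) :
    ‖z ^ (-criticalPoint t)‖ ≤ ‖z‖ ^ (-(1 / 2) : ℝ) *
      Real.exp (Real.pi / 2 * |t| - z.re / ‖z‖ * |t|) := by
  have hz0 : z ≠ 0 := by rintro rfl; simp at hz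
  rw [norm_cpow_of_ne_zero hz0, neg_re, neg_im, criticalPoint_re, criticalPoint_im, div_eq_mul_inv,
    ← Real.exp_neg]
  gcongr
  have h1 : |z.arg| ≤ Real.pi / 2 := abs_arg_le_pi_div_two_iff.mpr hz.le
  have h2 : Real.sin (Real.pi / 2 - |z.arg|) ≤ Real.pi / 2 - |z.arg| := Real.sin_le (by linarith)
  rw [Real.sin_pi_div_two_sub, Real.cos_abs, Complex.cos_arg hz0] at h2
  have h3 : -(z.arg * -t) ≤ |z.arg| * |t| := by
    rw [← abs_mul]
    simpa using le_abs_self (z.arg * t)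
  nlinarith [abs_nonneg t]

theorem norm_weight_mul_cpow_le {W : ℝ → ℂ} {C : ℝ}
    (hW : ∀ t, ‖W t‖ ≤ C * (1 + |t|) ^ 2 * Real.exp (-(Real.pi / 2 * |t|)))
    {z : ℂ} (hz : 0 < z.re) (t : ℝ) :
    ‖W t * z ^ (-criticalPoint t)‖ ≤ C * 16 * (‖z‖ ^ (-(1 / 2) : ℝ) * (‖z‖ / z.re) ^ 2) *
      Real.exp (-(z.re / ‖z‖ / 2 * |t|)) := by
  have hz0 : z ≠ 0 := by rintro rfl; simp at hz
  have hzn : 0 < ‖z‖ := norm_pos_iff.mpr hz0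
  have hC : 0 ≤ C := by simpa using (norm_nonneg _).trans (hW 0)
  have ha : 0 < z.re / ‖z‖ := by positivity
  have ha1 : z.re / ‖z‖ ≤ 1 := (div_le_one hzn).mpr (re_le_norm z)
  have h1 := one_add_abs_sq_mul_exp_le ha (by linarith) t
  calc ‖W t * z ^ (-criticalPoint t)‖
      ≤ (C * (1 + |t|) ^ 2 * Real.exp (-(Real.pi / 2 * |t|))) * (‖z‖ ^ (-(1 / 2) : ℝ) *
      Real.exp (Real.pi / 2 * |t| - z.re / ‖z‖ * |t|)) := by
        rw [norm_mul]
        exact mul_le_mul (hW t) (norm_cpow_criticalPoint_le hz t) (norm_nonneg _) (by positivity)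
    _ = C * ‖z‖ ^ (-(1 / 2) : ℝ) * ((1 + |t|) ^ 2 * (Real.exp (-(Real.pi / 2 * |t|)) *
      Real.exp (Real.pi / 2 * |t| - z.re / ‖z‖ * |t|))) := by ring
    _ = C * ‖z‖ ^ (-(1 / 2) : ℝ) * ((1 + |t|) ^ 2 * Real.exp (-(z.re / ‖z‖ * |t|))) := by
        rw [← Real.exp_add]
        ring_nf
    _ ≤ C * ‖z‖ ^ (-(1 / 2) : ℝ) * (16 / (z.re / ‖z‖) ^ 2 *
      Real.exp (-(z.re / ‖z‖ / 2 * |t|))) := by gcongr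
    _ = _ := by
        field_simp

theorem continuous_cpow_criticalPoint {z : ℂ} (hz : z ≠ 0) :
    Continuous fun t => z ^ (-criticalPoint t) :=
  continuous_criticalPoint.neg.const_cpow (Or.inl hz)

theorem integrable_weight_mul_cpow {W : ℝ → ℂ} (hWc : Continuous W) {C : ℝ}
    (hW : ∀ t, ‖W t‖ ≤ C * (1 + |t|) ^ 2 * Real.exp (-(Real.pi / 2 * |t|)))
    {z : ℂ} (hz : 0 < z.re) : Integrable fun t => W t * z ^ (-criticalPoint t) := by
  have hz0 : z ≠ 0 := by rintro rfl; simp at hz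
  have hzn : 0 < ‖z‖ := norm_pos_iff.mpr hz0
  exact ((integrable_exp_neg_mul_abs (by positivity)).const_mul _).mono'
    (hWc.mul (continuous_cpow_criticalPoint hz0)).aestronglyMeasurable
    (Eventually.of_forall fun t => norm_weight_mul_cpow_le hW hz t)

/-- A Mellin–Barnes integral over the critical line grows only like a power of `‖z‖ / re z` as `z`
approaches the imaginary axis. -/
theorem norm_integral_weight_mul_cpow_le {W : ℝ → ℂ} {C : ℝ}
    (hW : ∀ t, ‖W t‖ ≤ C * (1 + |t|) ^ 2 * Real.exp (-(Real.pi / 2 * |t|)))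
    {z : ℂ} (hz : 0 < z.re) : ‖∫ t, W t * z ^ (-criticalPoint t)‖ ≤
      64 * C * (‖z‖ ^ (-(1 / 2) : ℝ) * (‖z‖ / z.re) ^ 3) := by
  have hz0 : z ≠ 0 := by rintro rfl; simp at hz
  have hzn : 0 < ‖z‖ := norm_pos_iff.mpr hz0
  have ha : 0 < z.re / ‖z‖ / 2 := by positivity
  refine (norm_integral_le_of_norm_le ((integrable_exp_neg_mul_abs ha).const_mul _)
    (Eventually.of_forall fun t => norm_weight_mul_cpow_le hW hz t)).trans_eq ?_
  rw [integral_const_mul, integral_exp_neg_mul_abs ha]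
  field_simp
  ring

theorem norm_Gamma_weight_le (t : ℝ) : ‖Gamma (criticalPoint t)‖ ≤
    3 * (1 + |t|) ^ 2 * Real.exp (-(Real.pi / 2 * |t|)) := by
  refine (norm_Gamma_criticalPoint_le t).trans ?_
  gcongr
  nlinarith [abs_nonneg t, sq_nonneg |t|]

/-- Mellin inversion for `x ↦ exp (-z x)`, on the critical line. -/
theorem integral_Gamma_mul_cpow {z : ℂ} (hz : 0 < z.re) :
    ∫ t, Gamma (criticalPoint t) * z ^ (-criticalPoint t) = 2 * Real.pi * cexp (-z) := by
  have hcp : ∀ t : ℝ, (((1 / 2 : ℝ) : ℂ) + (t : ℂ) * I) = criticalPoint t := by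
    intro t; simp [criticalPoint]
  set f : ℝ → ℂ := fun x => cexp (-(z * x)) with hf
  have hmel : ∀ t : ℝ, mellin f (criticalPoint t) =
      Gamma (criticalPoint t) * z ^ (-criticalPoint t) := by
    intro t
    rw [mellin, mul_comm]
    exact integral_cpow_mul_exp_neg_complex_mul (by norm_num) hz
  have hconv : MellinConvergent f (((1 / 2 : ℝ) : ℂ)) := by
    have h0 : IntegrableOn (fun x : ℝ => x ^ (-(1 / 2) : ℝ) * Real.exp (-z.re * x)) (Ioi 0) := by
      simpa using integrableOn_rpow_mul_exp_neg_mul_rpow (p := 1) (s := -(1 / 2)) (b := z.re)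
        (by norm_num) (zero_lt_one) hz
    refine h0.mono' (ContinuousOn.aestronglyMeasurable ?_ measurableSet_Ioi) ?_
    · have hfc : Continuous f := by rw [hf]; fun_prop
      exact fun x hx => ((continuousAt_ofReal_cpow_const _ _ (Or.inr (ne_of_gt hx))).smul
        hfc.continuousAt).continuousWithinAt
    · refine (ae_restrict_mem measurableSet_Ioi).mono fun x hx => ?_
      rw [norm_smul, norm_cpow_eq_rpow_re_of_pos hx, norm_exp]
      simp
      norm_num
  have hvert : VerticalIntegrable (mellin f) (1 / 2 : ℝ) := by
    unfold VerticalIntegrable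
    simp_rw [hcp, hmel]
    exact integrable_weight_mul_cpow continuous_Gamma_criticalPoint norm_Gamma_weight_le hz
  have h := mellinInv_mellin_eq (1 / 2) f one_pos hconv hvert (by fun_prop)
  rw [mellinInv] at h
  simp only [hcp, hmel, ofReal_one, one_cpow, one_smul] at h
  simp only [hf, ofReal_one, mul_one] at h
  rw [← h, real_smul]
  have := Real.pi_ne_zero
  push_cast
  field_simp

/-! ### Multiplying a Mellin–Barnes integrand by zeta -/

theorem ofReal_mul_cpow {u : ℝ} (hu : 0 < u) {z : ℂ} (hz : z ≠ 0) (c : ℂ) :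
    ((u : ℂ) * z) ^ c = (u : ℂ) ^ c * z ^ c := by
  have hu0 : (u : ℂ) ≠ 0 := ofReal_ne_zero.mpr hu.ne'
  rw [cpow_def_of_ne_zero (mul_ne_zero hu0 hz), cpow_def_of_ne_zero hu0, cpow_def_of_ne_zero hz,
    log_ofReal_mul hu hz, ofReal_log hu.le, ← Complex.exp_add, add_mul]

theorem integral_cpow_neg_criticalPoint (N : ℕ) (t : ℝ) :
    ∫ u in Ioc (0 : ℝ) N, (u : ℂ) ^ (-criticalPoint t) =
      (N : ℂ) ^ (1 - criticalPoint t) / (1 - criticalPoint t) := by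
  have h0 : 1 - criticalPoint t ≠ 0 := sub_ne_zero.mpr (criticalPoint_ne_one t).symm
  rw [← intervalIntegral.integral_of_le (Nat.cast_nonneg N),
    integral_cpow (Or.inl (by rw [neg_re, criticalPoint_re]; norm_num))]
  have h1 : -criticalPoint t + 1 = 1 - criticalPoint t := by ring
  rw [h1, ofReal_zero, zero_cpow h0, sub_zero, ofReal_natCast]

/-- Multiplying a weight on the critical line by `ζ` amounts to replacing its Mellin–Barnes
integral `h` by the renormalised sum of the values `h (n z)`. -/
theorem tendsto_sum_sub_integral_of_weight {W : ℝ → ℂ} (hWc : Continuous W) {C : ℝ}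
    (hW : ∀ t, ‖W t‖ ≤ C * (1 + |t|) * Real.exp (-(Real.pi / 2 * |t|)))
    {z : ℂ} (hz : 0 < z.re) :
    (∀ N : ℕ, IntervalIntegrable (fun u : ℝ => ∫ t, W t * ((u : ℂ) * z) ^ (-criticalPoint t))
        volume 0 N) ∧
      Tendsto (fun N : ℕ =>
        (∑ n ∈ Finset.Icc 1 N, ∫ t, W t * ((n : ℂ) * z) ^ (-criticalPoint t)) -
          ∫ u in (0 : ℝ)..N, ∫ t, W t * ((u : ℂ) * z) ^ (-criticalPoint t))
      atTop (𝓝 (∫ t, W t * riemannZeta (criticalPoint t) * z ^ (-criticalPoint t))) := by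
  have hz0 : z ≠ 0 := by rintro rfl; simp at hz
  have hC : 0 ≤ C := by simpa using (norm_nonneg _).trans (hW 0)
  have hW2 : ∀ t, ‖W t‖ ≤ C * (1 + |t|) ^ 2 * Real.exp (-(Real.pi / 2 * |t|)) := by
    intro t
    refine (hW t).trans ?_
    gcongr
    nlinarith [abs_nonneg t, sq_nonneg |t|]
  have hWint : Integrable fun t => W t * z ^ (-criticalPoint t) :=
    integrable_weight_mul_cpow hWc hW2 hz
  have hnpos : ∀ n : ℕ, 1 ≤ n → (0 : ℝ) < n := fun n hn => by exact_mod_cast hn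
  have hnmul : ∀ n : ℕ, 1 ≤ n → ∀ c : ℂ, ((n : ℂ) * z) ^ c = (n : ℂ) ^ c * z ^ c := by
    intro n hn c
    exact_mod_cast ofReal_mul_cpow (hnpos n hn) hz0 c
  have hsum : ∀ N : ℕ, Integrable (fun t => W t *
      (∑ n ∈ Finset.Icc 1 N, (n : ℂ) ^ (-criticalPoint t)) * z ^ (-criticalPoint t)) ∧
      ∑ n ∈ Finset.Icc 1 N, ∫ t, W t * ((n : ℂ) * z) ^ (-criticalPoint t) =
      ∫ t, W t * (∑ n ∈ Finset.Icc 1 N, (n : ℂ) ^ (-criticalPoint t)) *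
        z ^ (-criticalPoint t) := by
    intro N
    have h1 : ∀ n ∈ Finset.Icc 1 N,
        Integrable fun t => W t * ((n : ℂ) * z) ^ (-criticalPoint t) := by
      intro n hn
      refine integrable_weight_mul_cpow hWc hW2 ?_
      have := mul_pos (hnpos n (Finset.mem_Icc.mp hn).1) hz
      simpa using this
    have h2 : (fun t => W t * (∑ n ∈ Finset.Icc 1 N, (n : ℂ) ^ (-criticalPoint t)) *
        z ^ (-criticalPoint t)) = fun t => ∑ n ∈ Finset.Icc 1 N,
          W t * ((n : ℂ) * z) ^ (-criticalPoint t) := by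
      funext t
      rw [Finset.mul_sum, Finset.sum_mul]
      refine Finset.sum_congr rfl fun n hn => ?_
      rw [hnmul n (Finset.mem_Icc.mp hn).1]
      ring
    rw [h2, integral_finsetSum _ h1]
    exact ⟨integrable_finsetSum _ h1, rfl⟩
  have hint : ∀ N : ℕ, Integrable (fun t => W t *
      ((N : ℂ) ^ (1 - criticalPoint t) / (1 - criticalPoint t)) * z ^ (-criticalPoint t)) ∧
      IntervalIntegrable (fun u : ℝ => ∫ t, W t * ((u : ℂ) * z) ^ (-criticalPoint t))
        volume 0 N ∧
      ∫ u in (0 : ℝ)..N, ∫ t, W t * ((u : ℂ) * z) ^ (-criticalPoint t) =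
      ∫ t, W t * ((N : ℂ) ^ (1 - criticalPoint t) / (1 - criticalPoint t)) *
        z ^ (-criticalPoint t) := by
    intro N
    -- Fubini is legitimate since `|u ^ (-s)| = u ^ (-1/2)` is integrable at `0`.
    have hu : IntegrableOn (fun u : ℝ => u ^ (-(1 / 2) : ℝ)) (Ioc 0 N) :=
      (intervalIntegral.intervalIntegrable_rpow' (a := 0) (b := N) (by norm_num)).1
    set g : ℝ × ℝ → ℂ := fun p => (p.1 : ℂ) ^ (-criticalPoint p.2) *
      (W p.2 * z ^ (-criticalPoint p.2)) with hg
    have hprod : Integrable g ((volume.restrict (Ioc (0 : ℝ) N)).prod volume) := by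
      refine (hu.mul_prod hWint.norm).mono' ?_ ?_
      · refine Measurable.aestronglyMeasurable ?_
        have m1 : Measurable fun p : ℝ × ℝ => (p.1 : ℂ) ^ (-criticalPoint p.2) :=
          (continuous_ofReal.measurable.comp measurable_fst).pow
            ((continuous_criticalPoint.measurable.comp measurable_snd).neg)
        exact m1.mul ((hWc.mul (continuous_cpow_criticalPoint hz0)).measurable.comp measurable_snd)
      · have hae : ∀ᵐ p ∂((volume.restrict (Ioc (0 : ℝ) N)).prod (volume : Measure ℝ)),
            p.1 ∈ Ioc (0 : ℝ) N :=
          Measure.quasiMeasurePreserving_fst.ae (ae_restrict_mem measurableSet_Ioc)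
        refine hae.mono fun p hp => ?_
        rw [hg]
        simp only [norm_mul]
        rw [norm_cpow_eq_rpow_re_of_pos hp.1, neg_re, criticalPoint_re]
    have heq : (fun t => W t * ((N : ℂ) ^ (1 - criticalPoint t) / (1 - criticalPoint t)) *
        z ^ (-criticalPoint t)) = fun t => ∫ u in Ioc (0 : ℝ) N, g (u, t) := by
      funext t
      simp only [hg]
      rw [integral_mul_const, integral_cpow_neg_criticalPoint]
      ring
    rw [heq]
    have hcongr : EqOn (fun u : ℝ => ∫ t, g (u, t))
        (fun u : ℝ => ∫ t, W t * ((u : ℂ) * z) ^ (-criticalPoint t)) (Ioc 0 N) := by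
      intro u hu
      refine integral_congr_ae (Eventually.of_forall fun t => ?_)
      simp only [hg]
      rw [ofReal_mul_cpow hu.1 hz0]
      ring
    refine ⟨hprod.integral_prod_right, ?_, ?_⟩
    · rw [intervalIntegrable_iff_integrableOn_Ioc_of_le (Nat.cast_nonneg N)]
      exact IntegrableOn.congr_fun hprod.integral_prod_left hcongr measurableSet_Ioc
    · rw [intervalIntegral.integral_of_le (Nat.cast_nonneg N),
        ← integral_integral_swap (f := fun u t => g (u, t)) hprod]
      exact setIntegral_congr_fun measurableSet_Ioc hcongr.symm
  have hcomb : ∀ N : ℕ, (∑ n ∈ Finset.Icc 1 N, ∫ t, W t * ((n : ℂ) * z) ^ (-criticalPoint t)) -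
      ∫ u in (0 : ℝ)..N, ∫ t, W t * ((u : ℂ) * z) ^ (-criticalPoint t) =
      ∫ t, W t * zetaApprox N (criticalPoint t) * z ^ (-criticalPoint t) := by
    intro N
    rw [(hsum N).2, (hint N).2.2, ← integral_sub (hsum N).1 (hint N).1]
    refine integral_congr_ae (Eventually.of_forall fun t => ?_)
    simp only [zetaApprox]
    ring
  refine ⟨fun N => (hint N).2.1, ?_⟩
  simp_rw [hcomb]
  refine tendsto_integral_filter_of_dominated_convergence
    (fun t => ‖((7 * C * (1 + |t|) ^ 2 * Real.exp (-(Real.pi / 2 * |t|)) : ℝ) : ℂ) *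
      z ^ (-criticalPoint t)‖) ?_ ?_ ?_ ?_
  · refine Eventually.of_forall fun N => ?_
    have : (fun t => W t * zetaApprox N (criticalPoint t) * z ^ (-criticalPoint t)) =
      (fun t => W t * (∑ n ∈ Finset.Icc 1 N, (n : ℂ) ^ (-criticalPoint t)) *
        z ^ (-criticalPoint t)) - (fun t => W t *
      ((N : ℂ) ^ (1 - criticalPoint t) / (1 - criticalPoint t)) * z ^ (-criticalPoint t)) := by
      funext t
      simp only [zetaApprox, Pi.sub_apply]
      ring
    rw [this]
    exact ((hsum N).1.sub (hint N).1).aestronglyMeasurable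
  · filter_upwards [eventually_ge_atTop 1] with N hN
    refine Eventually.of_forall fun t => ?_
    rw [norm_mul, norm_mul, norm_mul, norm_real]
    refine mul_le_mul_of_nonneg_right ?_ (norm_nonneg _)
    rw [Real.norm_of_nonneg (by positivity)]
    calc ‖W t‖ * ‖zetaApprox N (criticalPoint t)‖
        ≤ (C * (1 + |t|) * Real.exp (-(Real.pi / 2 * |t|))) * (7 * (1 + |t|)) :=
          mul_le_mul (hW t) (norm_zetaApprox_criticalPoint_le hN t) (norm_nonneg _) (by positivity)
      _ = _ := by ring
  · refine (integrable_weight_mul_cpow (C := 7 * C) (by fun_prop) (fun t => ?_) hz).norm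
    rw [norm_real, Real.norm_of_nonneg (by positivity)]
  · refine Eventually.of_forall fun t => ?_
    exact ((tendsto_zetaApprox (by norm_num) (criticalPoint_ne_one t)).const_mul _).mul_const _

/-! ### The Lambert series and its periodicity -/

theorem tendsto_exp_neg_natCast_mul {z : ℂ} (hz : 0 < z.re) :
    Tendsto (fun N : ℕ => cexp (-(N * z))) atTop (𝓝 0) := by
  have h1 : ‖cexp (-z)‖ < 1 := by
    rw [norm_exp, Real.exp_lt_one_iff, neg_re]
    linarith
  refine (tendsto_pow_atTop_nhds_zero_of_norm_lt_one h1).congr fun N => ?_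
  rw [← Complex.exp_nat_mul]
  ring_nf

theorem exp_ne_one_of_re_pos {z : ℂ} (hz : 0 < z.re) : cexp z ≠ 1 := by
  intro h
  have h1 := congrArg norm h
  rw [norm_exp, norm_one, Real.exp_eq_one_iff] at h1
  linarith

theorem sum_exp_neg_natCast_mul {z : ℂ} (hz : 0 < z.re) (N : ℕ) :
    ∑ n ∈ Finset.Icc 1 N, cexp (-(n * z)) = (1 - cexp (-(N * z))) / (cexp z - 1) := by
  have h1 : cexp z - 1 ≠ 0 := sub_ne_zero.mpr (exp_ne_one_of_re_pos hz)
  induction N with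
  | zero => simp
  | succ N ih =>
    rw [Finset.sum_Icc_succ_top (by omega), ih, eq_div_iff h1, add_mul, div_mul_cancel₀ _ h1]
    have h2 : cexp (-((N : ℕ) * z)) = cexp (-(((N + 1 : ℕ) : ℂ) * z)) * cexp z := by
      rw [← Complex.exp_add]
      push_cast
      ring_nf
    rw [h2]
    ring

/-- `Γ ζ` is the Mellin transform of `1 / (e^z - 1) - 1 / z` on the critical line. -/
theorem integral_Gamma_mul_zeta_mul_cpow {z : ℂ} (hz : 0 < z.re) :
    ∫ t, Gamma (criticalPoint t) * riemannZeta (criticalPoint t) * z ^ (-criticalPoint t) =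
      2 * Real.pi * (1 / (cexp z - 1) - 1 / z) := by
  have hz0 : z ≠ 0 := by rintro rfl; simp at hz
  have h := (tendsto_sum_sub_integral_of_weight continuous_Gamma_criticalPoint (C := 3)
    (fun t => (norm_Gamma_criticalPoint_le t).trans (by
      have : (0 : ℝ) ≤ |t| := abs_nonneg t
      gcongr
      linarith)) hz).2
  refine tendsto_nhds_unique h ?_
  have h0 : Tendsto (fun N : ℕ => (2 * Real.pi : ℂ) *
      ((1 - cexp (-(N * z))) * (1 / (cexp z - 1) - 1 / z))) atTop
      (𝓝 (2 * Real.pi * ((1 - 0) * (1 / (cexp z - 1) - 1 / z)))) :=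
    (((tendsto_exp_neg_natCast_mul hz).const_sub 1).mul_const _).const_mul _
  rw [sub_zero, one_mul] at h0
  refine h0.congr fun N => ?_
  have h1 : ∑ n ∈ Finset.Icc 1 N, ∫ t, Gamma (criticalPoint t) * ((n : ℂ) * z) ^
      (-criticalPoint t) = 2 * Real.pi * ((1 - cexp (-(N * z))) / (cexp z - 1)) := by
    rw [← sum_exp_neg_natCast_mul hz, Finset.mul_sum]
    refine Finset.sum_congr rfl fun n hn => integral_Gamma_mul_cpow ?_
    have hn0 : (0 : ℝ) < n := by exact_mod_cast (Finset.mem_Icc.mp hn).1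
    simpa using mul_pos hn0 hz
  have h2 : ∫ u in (0 : ℝ)..N, ∫ t, Gamma (criticalPoint t) * ((u : ℂ) * z) ^
      (-criticalPoint t) = 2 * Real.pi * ((1 - cexp (-(N * z))) / z) := by
    have h3 : ∫ u in (0 : ℝ)..N, ∫ t, Gamma (criticalPoint t) * ((u : ℂ) * z) ^
      (-criticalPoint t) = ∫ u in (0 : ℝ)..N, (2 * Real.pi : ℂ) * cexp (-z * u) := by
      rw [intervalIntegral.integral_of_le (Nat.cast_nonneg N),
        intervalIntegral.integral_of_le (Nat.cast_nonneg N)]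
      refine setIntegral_congr_fun measurableSet_Ioc fun u hu => ?_
      rw [integral_Gamma_mul_cpow (by simpa using mul_pos hu.1 hz)]
      ring_nf
    rw [h3, intervalIntegral.integral_const_mul, integral_exp_mul_complex (neg_ne_zero.mpr hz0)]
    congr 1
    have : -z * (N : ℂ) = -(N * z) := by ring
    simp only [ofReal_natCast, ofReal_zero, mul_zero, Complex.exp_zero, this]
    field_simp
    ring
  rw [h1, h2]
  ring

theorem log_mul_of_re_pos {a b : ℂ} (ha : 0 < a.re) (hb : 0 < b.re) :
    log (a * b) = log a + log b := by
  have ha0 : a ≠ 0 := by rintro rfl; simp at ha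
  have hb0 : b ≠ 0 := by rintro rfl; simp at hb
  have h1 := abs_lt.mp (abs_arg_lt_pi_div_two_iff.mpr (Or.inl ha))
  have h2 := abs_lt.mp (abs_arg_lt_pi_div_two_iff.mpr (Or.inl hb))
  exact Complex.log_mul ha0 hb0 ⟨by linarith [h1.1, h2.1], by linarith [h1.2, h2.2]⟩

/-- The primitive of `1 / (e^{uz} - 1) - 1 / (uz)` used below has limit `0` at `u = 0`. -/
theorem tendsto_log_one_sub_exp_sub_log {z : ℂ} (hz : 0 < z.re) :
    Tendsto (fun u : ℝ => log (1 - cexp (-(u * z))) - log (u * z)) (𝓝[>] 0) (𝓝 0) := by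
  have hz0 : z ≠ 0 := by rintro rfl; simp at hz
  have hq : Tendsto (fun u : ℝ => (1 - cexp (-(u * z))) / (u * z)) (𝓝[>] 0) (𝓝 1) := by
    have h1 : HasDerivAt (fun y : ℂ => 1 - cexp (-y)) 1 0 := by
      have := ((hasDerivAt_neg (0 : ℂ)).cexp).const_sub 1
      simpa using this
    have h2 := hasDerivAt_iff_tendsto_slope.mp h1
    have h3 : Tendsto (fun u : ℝ => (u : ℂ) * z) (𝓝[>] 0) (𝓝[≠] 0) := by
      refine tendsto_nhdsWithin_iff.mpr ⟨?_, ?_⟩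
      · have : Tendsto (fun u : ℝ => (u : ℂ) * z) (𝓝 0) (𝓝 (((0 : ℝ) : ℂ) * z)) :=
          (by fun_prop : Continuous fun u : ℝ => (u : ℂ) * z).tendsto 0
        rw [ofReal_zero, zero_mul] at this
        exact this.mono_left nhdsWithin_le_nhds
      · filter_upwards [self_mem_nhdsWithin] with u hu
        exact mul_ne_zero (ofReal_ne_zero.mpr (ne_of_gt hu)) hz0
    refine (h2.comp h3).congr fun u => ?_
    simp [slope_def_field]
  have hlog : Tendsto (fun u : ℝ => log ((1 - cexp (-(u * z))) / (u * z))) (𝓝[>] 0) (𝓝 0) := by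
    have := (continuousAt_clog one_mem_slitPlane).tendsto.comp hq
    rwa [log_one] at this
  have hre : ∀ᶠ u : ℝ in 𝓝[>] 0, 0 < ((1 - cexp (-(u * z))) / (u * z)).re :=
    hq.eventually ((isOpen_lt continuous_const continuous_re).mem_nhds (by simp))
  refine hlog.congr' ?_
  filter_upwards [hre, self_mem_nhdsWithin] with u hu hu0
  have hu0' : (0 : ℝ) < u := hu0
  have huz : (u : ℂ) * z ≠ 0 := mul_ne_zero (ofReal_ne_zero.mpr hu0'.ne') hz0
  have h4 := log_mul_of_re_pos (a := (u : ℂ) * z) (by simpa using mul_pos hu0' hz) hu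
  rw [mul_div_cancel₀ _ huz] at h4
  rw [h4]
  ring

theorem integral_inv_exp_sub_one_sub_inv {z : ℂ} (hz : 0 < z.re) {N : ℕ} (hN : 1 ≤ N)
    (hint : IntervalIntegrable (fun u : ℝ => 1 / (cexp (u * z) - 1) - 1 / (u * z)) volume 0 N) :
    ∫ u in (0 : ℝ)..N, (1 / (cexp (u * z) - 1) - 1 / (u * z)) =
      (log (1 - cexp (-(N * z))) - Real.log N - log z) / z := by
  have hz0 : z ≠ 0 := by rintro rfl; simp at hz
  have hN0 : (0 : ℝ) < N := by exact_mod_cast hN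
  have hre : ∀ u : ℝ, 0 < u → 0 < ((u : ℂ) * z).re := fun u hu => by
    simpa using mul_pos hu hz
  have hslit : ∀ u : ℝ, 0 < u → 1 - cexp (-(u * z)) ∈ slitPlane := by
    intro u hu
    left
    have h1 : (cexp (-(u * z))).re ≤ ‖cexp (-(u * z))‖ := re_le_norm _
    have h2 : ‖cexp (-(u * z))‖ < 1 := by
      rw [norm_exp, Real.exp_lt_one_iff, neg_re]
      linarith [hre u hu]
    rw [sub_re, one_re]
    linarith
  set Φ : ℝ → ℂ := fun u => (log (1 - cexp (-(u * z))) - log (u * z)) / z with hΦ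
  have hder : ∀ u : ℝ, 0 < u → HasDerivAt Φ (1 / (cexp (u * z) - 1) - 1 / (u * z)) u := by
    intro u hu
    have hl : HasDerivAt (fun u : ℝ => (u : ℂ) * z) z u := by
      simpa using ((hasDerivAt_id u).ofReal_comp).mul_const z
    have h1 : HasDerivAt (fun u : ℝ => 1 - cexp (-(u * z))) (-(cexp (-(u * z)) * -z)) u :=
      (hl.fun_neg.cexp).const_sub 1
    have h2 := h1.clog_real (hslit u hu)
    have h3 := hl.clog_real (Or.inl (hre u hu))
    refine ((h2.sub h3).div_const z).congr_deriv ?_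
    have h4 : cexp (u * z) - 1 ≠ 0 := sub_ne_zero.mpr (exp_ne_one_of_re_pos (hre u hu))
    have h5 : 1 - cexp (-(u * z)) = (cexp (u * z) - 1) * cexp (-(u * z)) := by
      rw [sub_mul, ← Complex.exp_add]; simp
    have h6 : cexp (-(u * z)) ≠ 0 := Complex.exp_ne_zero _
    have h7 : (u : ℂ) ≠ 0 := ofReal_ne_zero.mpr hu.ne'
    rw [h5]
    field_simp
  have h0 : Tendsto Φ (𝓝[>] 0) (𝓝 0) := by
    simpa using (tendsto_log_one_sub_exp_sub_log hz).div_const z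
  have hfin : Tendsto Φ (𝓝[<] (N : ℝ)) (𝓝 (Φ N)) :=
    (hder N hN0).continuousAt.tendsto.mono_left nhdsWithin_le_nhds
  rw [intervalIntegral.integral_eq_sub_of_hasDerivAt_of_tendsto hN0
    (fun u hu => hder u hu.1) hint h0 hfin, sub_zero, hΦ]
  simp only
  rw [log_ofReal_mul hN0 hz0]
  push_cast
  ring

/-- The Mellin–Barnes integral of `Γ ζ²` on the critical line. -/
noncomputable def zetaSqMellin (z : ℂ) : ℂ :=
  ∫ t, Gamma (criticalPoint t) * riemannZeta (criticalPoint t) ^ 2 * z ^ (-criticalPoint t)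

theorem norm_Gamma_mul_zeta_le (t : ℝ) :
    ‖Gamma (criticalPoint t) * riemannZeta (criticalPoint t)‖ ≤
      15 * (1 + |t|) * Real.exp (-(Real.pi / 2 * |t|)) := by
  rw [norm_mul]
  calc _ ≤ (3 * Real.exp (-(Real.pi / 2 * |t|))) * (5 * (1 + |t|)) :=
        mul_le_mul (norm_Gamma_criticalPoint_le t) (norm_riemannZeta_criticalPoint_le t)
          (norm_nonneg _) (by positivity)
    _ = _ := by ring

/-- The Mellin–Barnes integral of `Γ ζ²` is, up to an explicit elementary term, the Lambert series
`∑ 1 / (e^{nz} - 1)`. -/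
theorem tendsto_sum_inv_exp_sub_one {z : ℂ} (hz : 0 < z.re) :
    Tendsto (fun N : ℕ => ∑ n ∈ Finset.Icc 1 N, 1 / (cexp (n * z) - 1)) atTop
      (𝓝 (zetaSqMellin z / (2 * Real.pi) + (Real.eulerMascheroniConstant - log z) / z)) := by
  have hz0 : z ≠ 0 := by rintro rfl; simp at hz
  have hpi : (2 * Real.pi : ℂ) ≠ 0 := by simp [Real.pi_ne_zero]
  obtain ⟨hii, hlim⟩ := tendsto_sum_sub_integral_of_weight
    (W := fun t => Gamma (criticalPoint t) * riemannZeta (criticalPoint t))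
    (continuous_Gamma_criticalPoint.mul continuous_riemannZeta_criticalPoint)
    norm_Gamma_mul_zeta_le hz
  have hval : ∀ u : ℝ, 0 < u → ∫ t, Gamma (criticalPoint t) * riemannZeta (criticalPoint t) *
      ((u : ℂ) * z) ^ (-criticalPoint t) =
      2 * Real.pi * (1 / (cexp (u * z) - 1) - 1 / (u * z)) :=
    fun u hu => integral_Gamma_mul_zeta_mul_cpow (by simpa using mul_pos hu hz)
  have hK : ∫ t, Gamma (criticalPoint t) * riemannZeta (criticalPoint t) *
      riemannZeta (criticalPoint t) * z ^ (-criticalPoint t) = zetaSqMellin z := by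
    rw [zetaSqMellin]
    refine integral_congr_ae (Eventually.of_forall fun t => ?_)
    simp only
    ring
  rw [hK] at hlim
  have hexp : Tendsto (fun N : ℕ => log (1 - cexp (-(N * z)))) atTop (𝓝 0) := by
    have h1 := (tendsto_exp_neg_natCast_mul hz).const_sub 1
    rw [sub_zero] at h1
    have h2 := (continuousAt_clog one_mem_slitPlane).tendsto.comp h1
    rwa [log_one] at h2
  have hharm : Tendsto (fun N : ℕ => ((harmonic N - Real.log N : ℝ) : ℂ)) atTop
      (𝓝 (Real.eulerMascheroniConstant : ℂ)) :=
    (continuous_ofReal.tendsto _).comp Real.tendsto_harmonic_sub_log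
  have hall := (hlim.div_const (2 * Real.pi : ℂ)).add
    (((hharm.sub_const (log z)).add hexp).div_const z)
  rw [add_zero] at hall
  refine hall.congr' ?_
  filter_upwards [eventually_ge_atTop 1] with N hN
  have hI : IntervalIntegrable (fun u : ℝ => 1 / (cexp (u * z) - 1) - 1 / (u * z)) volume 0 N := by
    have h1 := (hii N).const_mul ((2 * Real.pi : ℂ)⁻¹)
    rw [intervalIntegrable_iff_integrableOn_Ioc_of_le (Nat.cast_nonneg N)] at h1 ⊢
    refine h1.congr_fun (fun u hu => ?_) measurableSet_Ioc
    simp only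
    rw [hval u hu.1, inv_mul_cancel_left₀ hpi]
  have h2 : ∫ u in (0 : ℝ)..N, ∫ t, Gamma (criticalPoint t) * riemannZeta (criticalPoint t) *
      ((u : ℂ) * z) ^ (-criticalPoint t) =
      2 * Real.pi * ((log (1 - cexp (-(N * z))) - Real.log N - log z) / z) := by
    rw [← integral_inv_exp_sub_one_sub_inv hz hN hI, ← intervalIntegral.integral_const_mul,
      intervalIntegral.integral_of_le (Nat.cast_nonneg N),
      intervalIntegral.integral_of_le (Nat.cast_nonneg N)]
    exact setIntegral_congr_fun measurableSet_Ioc fun u hu => hval u hu.1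
  have h3 : ∑ n ∈ Finset.Icc 1 N, ∫ t, Gamma (criticalPoint t) * riemannZeta (criticalPoint t) *
      ((n : ℂ) * z) ^ (-criticalPoint t) =
      2 * Real.pi * (∑ n ∈ Finset.Icc 1 N, 1 / (cexp (n * z) - 1) - harmonic N / z) := by
    have h4 : ((harmonic N : ℚ) : ℂ) / z = ∑ n ∈ Finset.Icc 1 N, 1 / ((n : ℂ) * z) := by
      rw [harmonic_eq_sum_Icc]
      push_cast
      rw [Finset.sum_div]
      refine Finset.sum_congr rfl fun n _ => ?_
      rw [one_div, mul_inv, div_eq_mul_inv]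
    rw [h4, ← Finset.sum_sub_distrib, Finset.mul_sum]
    refine Finset.sum_congr rfl fun n hn => ?_
    have := hval n (by exact_mod_cast (Finset.mem_Icc.mp hn).1)
    exact_mod_cast this
  rw [h2, h3]
  generalize ∑ n ∈ Finset.Icc 1 N, 1 / (cexp (n * z) - 1) = S
  push_cast
  field_simp
  ring

/-- The behaviour of `∫ Γ ζ² z^{-s}` near `2πi` is that near `0`, since both are expressed through
the `2πi`-periodic function `∑ 1 / (e^{nz} - 1)`. -/
theorem zetaSqMellin_add_two_pi_I {w : ℂ} (hw : 0 < w.re) :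
    zetaSqMellin (w + 2 * Real.pi * I) = zetaSqMellin w +
      2 * Real.pi * ((Real.eulerMascheroniConstant - log w) / w -
        (Real.eulerMascheroniConstant - log (w + 2 * Real.pi * I)) / (w + 2 * Real.pi * I)) := by
  have hpi : (2 * Real.pi : ℂ) ≠ 0 := by simp [Real.pi_ne_zero]
  have hz : 0 < (w + 2 * Real.pi * I).re := by simpa using hw
  have h1 := tendsto_sum_inv_exp_sub_one hw
  have h2 := tendsto_sum_inv_exp_sub_one hz
  have h3 : ∀ n : ℕ, cexp (n * (w + 2 * Real.pi * I)) = cexp (n * w) := by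
    intro n
    rw [mul_add, Complex.exp_add, Complex.exp_nat_mul_two_pi_mul_I, mul_one]
  simp_rw [h3] at h2
  have h4 := tendsto_nhds_unique h2 h1
  have h5 : zetaSqMellin (w + 2 * Real.pi * I) / (2 * Real.pi) = zetaSqMellin w / (2 * Real.pi) +
      ((Real.eulerMascheroniConstant - log w) / w -
        (Real.eulerMascheroniConstant - log (w + 2 * Real.pi * I)) / (w + 2 * Real.pi * I)) := by
    linear_combination h4
  rw [div_eq_iff hpi] at h5
  rw [h5, add_mul, div_mul_cancel₀ _ hpi]
  ring

theorem norm_Gamma_mul_zeta_sq_le (t : ℝ) :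
    ‖Gamma (criticalPoint t) * riemannZeta (criticalPoint t) ^ 2‖ ≤
      75 * (1 + |t|) ^ 2 * Real.exp (-(Real.pi / 2 * |t|)) := by
  rw [sq, ← mul_assoc, norm_mul]
  calc _ ≤ (15 * (1 + |t|) * Real.exp (-(Real.pi / 2 * |t|))) * (5 * (1 + |t|)) :=
        mul_le_mul (norm_Gamma_mul_zeta_le t) (norm_riemannZeta_criticalPoint_le t)
          (norm_nonneg _) (by positivity)
    _ = _ := by ring

theorem norm_zetaSqMellin_le {z : ℂ} (hz : 0 < z.re) :
    ‖zetaSqMellin z‖ ≤ 4800 * (‖z‖ ^ (-(1 / 2) : ℝ) * (‖z‖ / z.re) ^ 3) :=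
  (norm_integral_weight_mul_cpow_le norm_Gamma_mul_zeta_sq_le hz).trans_eq (by norm_num)

/-! ### The functional equation and Laplace transforms -/

theorem norm_zeta_sq_criticalPoint_le (t : ℝ) :
    ‖riemannZeta (criticalPoint t)‖ ^ 2 ≤ 25 * (1 + |t|) ^ 2 := by
  have := norm_riemannZeta_criticalPoint_le t
  calc _ ≤ (5 * (1 + |t|)) ^ 2 := by gcongr
    _ = _ := by ring

/-- The functional equation on the critical line. -/
theorem Gamma_mul_zeta_sq_mul_exp (t : ℝ) :
    Gamma (criticalPoint t) * riemannZeta (criticalPoint t) ^ 2 *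
      (2 * Real.pi : ℂ) ^ (-criticalPoint t) * cexp (-(Real.pi * I / 2 * criticalPoint t)) *
        (1 + I * Real.exp (-(Real.pi * t))) = (‖riemannZeta (criticalPoint t)‖ ^ 2 : ℝ) := by
  set s := criticalPoint t with hs
  have h1 : (1 : ℂ) - s = (starRingEnd ℂ) s := by
    apply Complex.ext <;> simp [hs]
    norm_num
  have hsn : ∀ n : ℕ, s ≠ -n := by
    intro n h
    have := congrArg Complex.re h
    simp only [hs, criticalPoint_re, neg_re, natCast_re] at this
    have h2 : (0 : ℝ) ≤ n := Nat.cast_nonneg n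
    linarith
  have h2 := riemannZeta_one_sub hsn (criticalPoint_ne_one t)
  have h3 : ((‖riemannZeta s‖ ^ 2 : ℝ) : ℂ) = riemannZeta s * riemannZeta (1 - s) := by
    rw [h1, riemannZeta_conj, mul_conj, normSq_eq_norm_sq]
  have h4 : I * (Real.exp (-(Real.pi * t)) : ℂ) = cexp (Real.pi * I * s) := by
    have : (Real.pi : ℂ) * I * s = Real.pi / 2 * I + ((-(Real.pi * t) : ℝ) : ℂ) := by
      rw [hs, criticalPoint]
      push_cast
      linear_combination (Real.pi * t : ℂ) * I_mul_I
    rw [this, Complex.exp_add, Complex.exp_pi_div_two_mul_I, ofReal_exp]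
  have h5 : cexp (-(Real.pi * I / 2 * s)) * cexp (Real.pi * I * s) =
      cexp (Real.pi * I / 2 * s) := by
    rw [← Complex.exp_add]
    ring_nf
  have h6 : 2 * cos (Real.pi * s / 2) =
      cexp (Real.pi * I / 2 * s) + cexp (-(Real.pi * I / 2 * s)) := by
    rw [Complex.two_cos]
    ring_nf
  rw [h3, h2, h4, mul_add, mul_one, mul_assoc _ (cexp (-(Real.pi * I / 2 * s))), h5]
  linear_combination (-(riemannZeta s ^ 2 * (2 * Real.pi : ℂ) ^ (-s) * Gamma s)) * h6

theorem one_add_I_mul_ofReal_ne_zero (x : ℝ) : (1 : ℂ) + I * x ≠ 0 := by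
  intro h
  have := congrArg Complex.re h
  simp at this

/-- The rotated argument stays in the right half-plane, so that its principal logarithm is
the obvious one. -/
theorem log_two_pi_I_mul_exp {η : ℂ} (h0 : 0 < η.re) (h1 : η.re ≤ 1) :
    log (2 * Real.pi * I * cexp (-(I * η))) = Real.log (2 * Real.pi) + Real.pi * I / 2 - I * η := by
  have hpi := Real.pi_gt_three
  have h2 : 2 * Real.pi * I * cexp (-(I * η)) =
      cexp (Real.log (2 * Real.pi) + Real.pi * I / 2 - I * η) := by
    rw [sub_eq_add_neg, Complex.exp_add, Complex.exp_add, ← ofReal_exp,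
      Real.exp_log (by positivity), show (Real.pi : ℂ) * I / 2 = Real.pi / 2 * I by ring,
      Complex.exp_pi_div_two_mul_I]
    push_cast
    ring
  have h3 : ((Real.log (2 * Real.pi) : ℂ) + Real.pi * I / 2 - I * η).im = Real.pi / 2 - η.re := by
    have : (Real.pi : ℂ) * I / 2 = ((Real.pi / 2 : ℝ) : ℂ) * I := by push_cast; ring
    rw [this, sub_im, add_im, ofReal_im, im_ofReal_mul, I_im, I_mul_im]
    ring
  rw [h2, Complex.log_exp] <;> rw [h3] <;> linarith

/-- Near `2πi`, in the coordinate `2πi exp(-iη)`, the integrand of the Mellin–Barnes integral is that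
of the Laplace transform of `|ζ|²`, up to the factor `1 / (1 + i e^{-πt})`, which is close to `1` for
positive `t` and to `0` for negative `t`. -/
theorem Gamma_mul_zeta_sq_mul_cpow_eq {η : ℂ} (h0 : 0 < η.re) (h1 : η.re ≤ 1) (t : ℝ) :
    Gamma (criticalPoint t) * riemannZeta (criticalPoint t) ^ 2 *
      (2 * Real.pi * I * cexp (-(I * η))) ^ (-criticalPoint t) =
    cexp (I * η / 2) * ((‖riemannZeta (criticalPoint t)‖ ^ 2 : ℝ) * cexp (-(η * t)) /
      (1 + I * Real.exp (-(Real.pi * t)))) := by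
  have hne : 2 * Real.pi * I * cexp (-(I * η)) ≠ 0 := by
    simp [Real.pi_ne_zero]
  have h2 : (2 * Real.pi : ℂ) ≠ 0 := by simp [Real.pi_ne_zero]
  have h3 : (2 * Real.pi : ℂ) = ((2 * Real.pi : ℝ) : ℂ) := by push_cast; ring
  have h4 : log (2 * Real.pi : ℂ) = Real.log (2 * Real.pi) := by
    rw [h3, ofReal_log (by positivity)]
  rw [← mul_div_assoc, eq_div_iff (one_add_I_mul_ofReal_ne_zero _),
    ← Gamma_mul_zeta_sq_mul_exp t, cpow_def_of_ne_zero hne, log_two_pi_I_mul_exp h0 h1,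
    cpow_def_of_ne_zero h2, h4]
  have h5 : cexp ((Real.log (2 * Real.pi) + Real.pi * I / 2 - I * η) * -criticalPoint t) =
      cexp (I * η / 2) * (cexp (Real.log (2 * Real.pi) * -criticalPoint t) *
        cexp (-(Real.pi * I / 2 * criticalPoint t)) * cexp (-(η * t))) := by
    rw [← Complex.exp_add, ← Complex.exp_add, ← Complex.exp_add]
    congr 1
    rw [criticalPoint]
    linear_combination (η * t) * I_mul_I
  rw [h5]
  ring

theorem integrable_zeta_sq_mul_exp {η : ℂ} (h0 : 0 < η.re) :
    IntegrableOn (fun t : ℝ => ((‖riemannZeta (criticalPoint t)‖ ^ 2 : ℝ) : ℂ) * cexp (-(η * t)))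
      (Ioi 0) := by
  set a := min η.re 1 with ha
  have ha0 : 0 < a := lt_min h0 one_pos
  refine (((integrable_exp_neg_mul_abs (a := a / 2) (by positivity)).const_mul
    (25 * (16 / a ^ 2))).integrableOn).mono' ?_ ?_
  · have := continuous_riemannZeta_criticalPoint
    exact (by fun_prop : Continuous fun t : ℝ =>
      ((‖riemannZeta (criticalPoint t)‖ ^ 2 : ℝ) : ℂ) * cexp (-(η * t))).aestronglyMeasurable
  · refine (ae_restrict_mem measurableSet_Ioi).mono fun t ht => ?_
    have ht0 : (0 : ℝ) < t := ht
    have h1 := one_add_abs_sq_mul_exp_le ha0 (by linarith [min_le_right η.re 1]) t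
    rw [norm_mul, norm_real, Real.norm_of_nonneg (by positivity), norm_exp]
    have h2 : (-(η * t)).re ≤ -(a * |t|) := by
      rw [neg_re, re_mul_ofReal, abs_of_pos ht0]
      have := min_le_left η.re 1
      have : a * t ≤ η.re * t := by gcongr
      linarith
    calc _ ≤ 25 * (1 + |t|) ^ 2 * Real.exp (-(a * |t|)) := by
          gcongr
          exact norm_zeta_sq_criticalPoint_le t
      _ = 25 * ((1 + |t|) ^ 2 * Real.exp (-(a * |t|))) := by ring
      _ ≤ 25 * (16 / a ^ 2 * Real.exp (-(a / 2 * |t|))) := by gcongr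
      _ = _ := by ring

theorem norm_indicator_sub_inv_le (t : ℝ) :
    ‖(Ioi (0 : ℝ)).indicator (fun _ => (1 : ℂ)) t - 1 / (1 + I * Real.exp (-(Real.pi * t)))‖ ≤
      Real.exp (-(Real.pi * |t|)) := by
  set x := Real.exp (-(Real.pi * t)) with hx
  have hx0 : 0 < x := Real.exp_pos _
  have hne := one_add_I_mul_ofReal_ne_zero x
  have h1 : 1 ≤ ‖1 + I * (x : ℂ)‖ := by
    refine le_trans ?_ (abs_re_le_norm _)
    simp
  have h2 : x ≤ ‖1 + I * (x : ℂ)‖ := by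
    refine le_trans ?_ (abs_im_le_norm _)
    simp [abs_of_pos hx0]
  by_cases ht : 0 < t
  · rw [indicator_of_mem (show t ∈ Ioi 0 from ht), abs_of_pos ht, ← hx]
    have : (1 : ℂ) - 1 / (1 + I * x) = I * x / (1 + I * x) := by field_simp; ring
    rw [this, norm_div, norm_mul, norm_I, one_mul, norm_real, Real.norm_of_nonneg hx0.le]
    exact div_le_self hx0.le h1
  · have h3 : Real.exp (-(Real.pi * |t|)) = 1 / x := by
      rw [hx, abs_of_nonpos (not_lt.mp ht), one_div, ← Real.exp_neg]
      ring_nf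
    rw [indicator_of_notMem (show t ∉ Ioi 0 from ht), zero_sub, norm_neg, norm_div, norm_one, h3]
    exact one_div_le_one_div_of_le hx0 h2

theorem re_two_pi_I_mul_exp (η : ℂ) :
    (2 * Real.pi * I * cexp (-(I * η))).re = 2 * Real.pi * (Real.exp η.im * Real.sin η.re) := by
  have h1 : (2 * Real.pi * I * cexp (-(I * η)) : ℂ) =
      ((2 * Real.pi : ℝ) : ℂ) * (I * cexp (-(I * η))) := by
    push_cast; ring
  rw [h1, re_ofReal_mul, I_mul_re, exp_im]
  simp

/-- The Laplace transform of `|ζ(1/2 + it)|²` is, up to a bounded error, the Mellin–Barnes integral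
of `Γ ζ²` at a point near `2πi`. -/
theorem norm_laplace_zeta_sq_sub_le {η : ℂ} (h0 : 0 < η.re) (h1 : η.re ≤ 1) :
    ‖(∫ t in Ioi (0 : ℝ), ((‖riemannZeta (criticalPoint t)‖ ^ 2 : ℝ) : ℂ) * cexp (-(η * t))) -
      cexp (-(I * η / 2)) * zetaSqMellin (2 * Real.pi * I * cexp (-(I * η)))‖ ≤ 200 := by
  have hre : 0 < (2 * Real.pi * I * cexp (-(I * η))).re := by
    rw [re_two_pi_I_mul_exp]
    have := Real.sin_pos_of_pos_of_lt_pi h0 (by linarith [Real.pi_gt_three])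
    have := Real.pi_pos
    positivity
  set f : ℝ → ℂ := fun t => ((‖riemannZeta (criticalPoint t)‖ ^ 2 : ℝ) : ℂ) * cexp (-(η * t))
    with hf
  have hK : cexp (-(I * η / 2)) * zetaSqMellin (2 * Real.pi * I * cexp (-(I * η))) =
      ∫ t, f t / (1 + I * Real.exp (-(Real.pi * t))) := by
    rw [zetaSqMellin]
    simp_rw [Gamma_mul_zeta_sq_mul_cpow_eq h0 h1]
    rw [integral_const_mul, ← mul_assoc, ← Complex.exp_add]
    simp [hf]
  have hint : Integrable fun t => f t / (1 + I * Real.exp (-(Real.pi * t))) := by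
    have h2 : Integrable fun t => Gamma (criticalPoint t) * riemannZeta (criticalPoint t) ^ 2 *
        (2 * Real.pi * I * cexp (-(I * η))) ^ (-criticalPoint t) :=
      integrable_weight_mul_cpow (continuous_Gamma_criticalPoint.mul
        (continuous_riemannZeta_criticalPoint.pow 2)) norm_Gamma_mul_zeta_sq_le hre
    simp_rw [Gamma_mul_zeta_sq_mul_cpow_eq h0 h1] at h2
    have h3 := h2.const_mul (cexp (-(I * η / 2)))
    refine h3.congr (Eventually.of_forall fun t => ?_)
    simp only
    rw [← mul_assoc, ← Complex.exp_add]
    simp [hf]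
  have hfi : IntegrableOn f (Ioi 0) := integrable_zeta_sq_mul_exp h0
  rw [hK, ← integral_indicator measurableSet_Ioi,
    ← integral_sub (hfi.integrable_indicator measurableSet_Ioi) hint]
  have hpi := Real.pi_gt_three
  refine (norm_integral_le_of_norm_le ((integrable_exp_neg_mul_abs (a := 1) one_pos).const_mul 100)
    (Eventually.of_forall fun t => ?_)).trans_eq ?_
  · have h4 : (Ioi (0 : ℝ)).indicator f t - f t / (1 + I * Real.exp (-(Real.pi * t))) =
        f t * ((Ioi (0 : ℝ)).indicator (fun _ => (1 : ℂ)) t -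
          1 / (1 + I * Real.exp (-(Real.pi * t)))) := by
      by_cases ht : t ∈ Ioi (0 : ℝ)
      · rw [indicator_of_mem ht, indicator_of_mem ht]; ring
      · rw [indicator_of_notMem ht, indicator_of_notMem ht]; ring
    have h5 : ‖f t‖ ≤ 25 * (1 + |t|) ^ 2 * Real.exp |t| := by
      rw [hf]
      simp only
      rw [norm_mul, norm_real, Real.norm_of_nonneg (by positivity), norm_exp]
      gcongr
      · exact norm_zeta_sq_criticalPoint_le t
      · rw [neg_re, re_mul_ofReal]
        have h6 : -(η.re * t) ≤ η.re * |t| := by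
          nlinarith [neg_abs_le t]
        nlinarith [abs_nonneg t]
    -- The factor `e^{-π|t|}` beats `|e^{-ηt}| ≤ e^{|t|}` with a margin of `e^{-2|t|}`.
    have h7 := one_add_abs_sq_mul_exp_le (a := 2) (by norm_num) (by norm_num) t
    rw [h4, norm_mul]
    calc _ ≤ (25 * (1 + |t|) ^ 2 * Real.exp |t|) * Real.exp (-(Real.pi * |t|)) :=
          mul_le_mul h5 (norm_indicator_sub_inv_le t) (norm_nonneg _) (by positivity)
      _ = 25 * (1 + |t|) ^ 2 * Real.exp (|t| - Real.pi * |t|) := by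
          rw [mul_assoc, ← Real.exp_add]; ring_nf
      _ ≤ 25 * (1 + |t|) ^ 2 * Real.exp (-(2 * |t|)) := by
          gcongr
          nlinarith [abs_nonneg t]
      _ = 25 * ((1 + |t|) ^ 2 * Real.exp (-(2 * |t|))) := by ring
      _ ≤ 25 * (16 / 2 ^ 2 * Real.exp (-(2 / 2 * |t|))) := by gcongr
      _ = _ := by norm_num; ring
  · rw [integral_const_mul, integral_exp_neg_mul_abs one_pos]
    norm_num

/-- The Laplace transform of the logarithm, as the derivative at `a = 1` of Euler's integral
`∫ t^{a-1} e^{-ηt} dt = η^{-a} Γ(a)`. -/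
theorem integral_log_mul_exp_neg_mul {η : ℂ} (h0 : 0 < η.re) :
    IntegrableOn (fun t : ℝ => (Real.log t : ℂ) * cexp (-(η * t))) (Ioi 0) ∧
    ∫ t in Ioi (0 : ℝ), (Real.log t : ℂ) * cexp (-(η * t)) =
      -(Real.eulerMascheroniConstant + log η) / η := by
  have hη : η ≠ 0 := by rintro rfl; simp at h0
  set f : ℝ → ℂ := fun t => cexp (-(η * t)) with hf
  have hfc : Continuous f := by rw [hf]; fun_prop
  have hnorm : ∀ t, ‖f t‖ = Real.exp (-η.re * t) := by
    intro t
    rw [hf, norm_exp]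
    simp
  have hloc : LocallyIntegrableOn f (Ioi 0) := (hfc.locallyIntegrable).locallyIntegrableOn _
  have htop : f =O[atTop] fun t => t ^ (-(2 : ℝ)) := by
    refine Asymptotics.IsBigO.trans ?_ (isLittleO_exp_neg_mul_rpow_atTop h0 (-2)).isBigO
    exact Asymptotics.isBigO_of_le _ fun t => by
      rw [hnorm, Real.norm_of_nonneg (Real.exp_pos _).le]
  have hbot : f =O[𝓝[>] 0] fun t => t ^ (-(0 : ℝ)) := by
    simp only [neg_zero, Real.rpow_zero]
    exact ((hfc.tendsto 0).mono_left nhdsWithin_le_nhds).isBigO_one ℝ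
  obtain ⟨hc, hd⟩ := mellin_hasDerivAt_of_isBigO_rpow (s := 1) hloc htop (by simp) hbot (by simp)
  have hd2 : HasDerivAt (mellin f) (-(Real.eulerMascheroniConstant + log η) / η) 1 := by
    have h1 : HasDerivAt (fun a : ℂ => η ^ (-a) * Gamma a)
        (η ^ (-1 : ℂ) * log η * -1 * Gamma 1 + η ^ (-1 : ℂ) * -Real.eulerMascheroniConstant) 1 :=
      ((hasDerivAt_neg (1 : ℂ)).const_cpow (Or.inl hη)).mul Complex.hasDerivAt_Gamma_one
    have h2 : η ^ (-1 : ℂ) * log η * -1 * Gamma 1 + η ^ (-1 : ℂ) * -Real.eulerMascheroniConstant =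
        -(Real.eulerMascheroniConstant + log η) / η := by
      rw [Gamma_one, cpow_neg_one]
      field_simp
      ring
    rw [h2] at h1
    refine h1.congr_of_eventuallyEq ?_
    filter_upwards [(isOpen_lt continuous_const continuous_re).mem_nhds
      (show (0 : ℝ) < (1 : ℂ).re by simp)] with a ha
    rw [← integral_cpow_mul_exp_neg_complex_mul ha h0]
    rfl
  constructor
  · have := hc
    simpa [MellinConvergent, hf] using this
  · rw [← hd.unique hd2, mellin]
    simp [hf]

/-! ### The Laplace transform of the squared zeta function near the origin -/

/-- In the coordinate `2πi exp(-iη) = w + 2πi`, the small quantity `w` is `2πη` times a factor `q`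
close to `1`. -/
theorem exists_two_pi_I_mul_exp_eq {η : ℂ} (h0 : 0 < η.re) (hη : ‖η‖ ≤ 1 / 4) :
    ∃ q w : ℂ, w = 2 * Real.pi * η * q ∧ 2 * Real.pi * I * cexp (-(I * η)) = w + 2 * Real.pi * I ∧
      ‖q - 1‖ ≤ ‖η‖ ∧ η.re ≤ w.re := by
  have hδη : η.re ≤ ‖η‖ := re_le_norm η
  have hη0 : 0 < ‖η‖ := h0.trans_le hδη
  have hηne : η ≠ 0 := norm_pos_iff.mp hη0
  have hxn : ‖-(I * η)‖ = ‖η‖ := by rw [norm_neg, norm_mul, norm_I, one_mul]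
  refine ⟨I * (cexp (-(I * η)) - 1) / η, 2 * Real.pi * I * cexp (-(I * η)) - 2 * Real.pi * I,
    ?_, by ring, ?_, ?_⟩
  · field_simp
  · have h1 : I * (cexp (-(I * η)) - 1) / η - 1 =
        I * (cexp (-(I * η)) - 1 - -(I * η)) / η := by
      field_simp
      linear_combination (-η) * I_mul_I
    rw [h1, norm_div, norm_mul, norm_I, one_mul, div_le_iff₀ hη0, ← sq, ← hxn]
    exact norm_exp_sub_one_sub_id_le (by linarith)
  · have him : |η.im| ≤ 1 / 4 := (abs_im_le_norm η).trans hη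
    have hpi3 := Real.pi_gt_three
    rw [sub_re, re_two_pi_I_mul_exp]
    have h1 : η.re * (2 / Real.pi) ≤ Real.sin η.re := by
      have := Real.mul_le_sin h0.le (by linarith)
      linarith
    have h2 : 3 / 4 ≤ Real.exp η.im := by
      have := Real.add_one_le_exp η.im
      linarith [(abs_le.mp him).1]
    have h3 : 3 / 4 * (η.re * (2 / Real.pi)) ≤ Real.exp η.im * Real.sin η.re := by gcongr
    have h4 : 2 * Real.pi * (3 / 4 * (η.re * (2 / Real.pi))) = 3 * η.re := by
      field_simp
      norm_num
    have h5 := mul_le_mul_of_nonneg_left h3 (by positivity : 0 ≤ 2 * Real.pi)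
    have h6 : (2 * Real.pi * I : ℂ).re = 0 := by simp
    rw [h6]
    linarith

theorem norm_euler_sub_log_div_le {w : ℂ} (hw : ‖w‖ ≤ 2) :
    ‖(Real.eulerMascheroniConstant - log (w + 2 * Real.pi * I)) / (w + 2 * Real.pi * I)‖ ≤ 20 := by
  have hpi3 := Real.pi_gt_three
  have hpi4 := Real.pi_lt_d2
  have hγ0 := Real.one_half_lt_eulerMascheroniConstant
  have hγ1 := Real.eulerMascheroniConstant_lt_two_thirds
  have hn : ‖(2 * Real.pi * I : ℂ)‖ = 2 * Real.pi := by simp [abs_of_pos Real.pi_pos]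
  have h1 : 1 ≤ ‖w + 2 * Real.pi * I‖ := by
    have := norm_sub_norm_le (2 * Real.pi * I : ℂ) (-w)
    rw [sub_neg_eq_add, norm_neg, hn, add_comm (2 * Real.pi * I : ℂ)] at this
    linarith
  have h2 : ‖w + 2 * Real.pi * I‖ ≤ 9 := by
    refine (norm_add_le _ _).trans ?_
    rw [hn]
    linarith
  have h3 : ‖log (w + 2 * Real.pi * I)‖ ≤ 13 := by
    refine (norm_le_abs_re_add_abs_im _).trans ?_
    rw [log_re, log_im, abs_of_nonneg (Real.log_nonneg h1)]
    have h4 := Real.log_le_sub_one_of_pos (zero_lt_one.trans_le h1)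
    have h5 := abs_arg_le_pi (w + 2 * Real.pi * I)
    linarith
  rw [norm_div]
  refine (div_le_self (norm_nonneg _) h1).trans ((norm_sub_le _ _).trans ?_)
  rw [norm_real, Real.norm_of_nonneg (by linarith)]
  linarith

theorem norm_euler_sub_log_two_pi_mul_le {η : ℂ} (h0 : 0 < η.re) (hη : ‖η‖ ≤ 1 / 4) :
    ‖Real.eulerMascheroniConstant - log (2 * Real.pi * η)‖ ≤ 8 * η.re ^ (-(1 / 2) : ℝ) := by
  have hpi3 := Real.pi_gt_three
  have hpi4 := Real.pi_lt_d2
  have hγ0 := Real.one_half_lt_eulerMascheroniConstant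
  have hγ1 := Real.eulerMascheroniConstant_lt_two_thirds
  have hδη : η.re ≤ ‖η‖ := re_le_norm η
  have hη0 : 0 < ‖η‖ := h0.trans_le hδη
  have hD1 : 1 ≤ η.re ^ (-(1 / 2) : ℝ) :=
    Real.one_le_rpow_of_pos_of_le_one_of_nonpos h0 (by linarith) (by norm_num)
  have hn : ‖(2 * Real.pi * η : ℂ)‖ = 2 * Real.pi * ‖η‖ := by simp [abs_of_pos Real.pi_pos]
  have hpos : 0 < 2 * Real.pi * ‖η‖ := by positivity
  have h1 : |Real.log (2 * Real.pi * ‖η‖)| ≤ 1 + 2 * η.re ^ (-(1 / 2) : ℝ) := by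
    rw [abs_le]
    constructor
    · have h2 : Real.log η.re ≤ Real.log (2 * Real.pi * ‖η‖) :=
        Real.log_le_log h0 (by nlinarith)
      have h3 : Real.log η.re⁻¹ ≤ η.re⁻¹ ^ (1 / 2 : ℝ) / (1 / 2) :=
        Real.log_le_rpow_div (by positivity) (by norm_num)
      rw [Real.log_inv, Real.inv_rpow h0.le, ← Real.rpow_neg h0.le] at h3
      linarith
    · have h2 := Real.log_le_sub_one_of_pos hpos
      nlinarith
  have h2 : ‖log (2 * Real.pi * η)‖ ≤ 1 + 2 * η.re ^ (-(1 / 2) : ℝ) + 4 := by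
    refine (norm_le_abs_re_add_abs_im _).trans ?_
    rw [log_re, log_im, hn]
    have := abs_arg_le_pi (2 * Real.pi * η)
    linarith
  refine (norm_sub_le _ _).trans ?_
  rw [norm_real, Real.norm_of_nonneg (by linarith)]
  linarith

/-- The main term `c (γ - log w) / w`, for `w = 2πηq`, differs from its value for `q = c = 1` by a
quantity that grows only logarithmically at `η = 0`: the errors in `q` and `c` cancel the pole. -/
theorem norm_main_term_sub_le {η q c : ℂ} {E : ℝ} (h0 : 0 < η.re) (hη : ‖η‖ ≤ 1 / 4)
    (hq1 : ‖q - 1‖ ≤ ‖η‖) (hc1 : ‖c - 1‖ ≤ ‖η‖) (hE1 : 1 ≤ E)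
    (hΛ : ‖Real.eulerMascheroniConstant - log (2 * Real.pi * η)‖ ≤ 8 * E) :
    ‖c * (2 * Real.pi * ((Real.eulerMascheroniConstant - log (2 * Real.pi * η * q)) /
        (2 * Real.pi * η * q))) - (Real.eulerMascheroniConstant - log (2 * Real.pi * η)) / η‖ ≤
      100 * E := by
  have hη0 : 0 < ‖η‖ := h0.trans_le (re_le_norm η)
  have hηne : η ≠ 0 := norm_pos_iff.mp hη0
  have hqre : 0 < q.re := by
    have h1 := abs_re_le_norm (q - 1)
    rw [sub_re, one_re] at h1
    have := (abs_le.mp (h1.trans hq1)).1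
    linarith
  have hqn : 3 / 4 ≤ ‖q‖ := by
    have h1 := norm_sub_norm_le (1 : ℂ) q
    rw [norm_sub_rev, norm_one] at h1
    linarith
  have hqne : q ≠ 0 := norm_pos_iff.mp (by linarith)
  have hcn : ‖c‖ ≤ 2 := by
    have := norm_sub_norm_le c 1
    rw [norm_one] at this
    linarith
  have hlogq : ‖log q‖ ≤ 3 / 2 * ‖η‖ := by
    have := norm_log_one_add_half_le_self (z := q - 1) (by linarith)
    rw [add_sub_cancel] at this
    linarith
  have hlog : log (2 * Real.pi * η * q) = log (2 * Real.pi * η) + log q := by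
    refine log_mul_of_re_pos ?_ hqre
    have : (2 * Real.pi * η : ℂ) = ((2 * Real.pi : ℝ) : ℂ) * η := by push_cast; ring
    rw [this, re_ofReal_mul]
    have := Real.pi_pos
    positivity
  have hpin : (Real.pi : ℂ) ≠ 0 := ofReal_ne_zero.mpr Real.pi_ne_zero
  rw [hlog]
  generalize (Real.eulerMascheroniConstant : ℂ) = γ at *
  generalize log (2 * Real.pi * η) = ℓ at *
  generalize log q = ℓq at *
  have h1 : c * (2 * Real.pi * ((γ - (ℓ + ℓq)) / (2 * Real.pi * η * q))) - (γ - ℓ) / η =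
      ((γ - ℓ) * ((c - 1) - (q - 1)) - c * ℓq) / (η * q) := by
    field_simp
    ring
  rw [h1, norm_div, norm_mul, div_le_iff₀ (by positivity)]
  have h2 : ‖(γ - ℓ) * ((c - 1) - (q - 1))‖ ≤ 8 * E * (2 * ‖η‖) := by
    rw [norm_mul]
    gcongr
    exact (norm_sub_le _ _).trans (by linarith)
  have h3 : ‖c * ℓq‖ ≤ 2 * (3 / 2 * ‖η‖) := by
    rw [norm_mul]
    gcongr
  have h4 := norm_sub_le ((γ - ℓ) * ((c - 1) - (q - 1))) (c * ℓq)
  have h5 : 100 * E * (‖η‖ * (3 / 4)) ≤ 100 * E * (‖η‖ * ‖q‖) := by gcongr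
  have h6 : ‖η‖ ≤ E * ‖η‖ := le_mul_of_one_le_left hη0.le hE1
  linarith

/-- The error estimate for the Laplace transform of `|ζ(1/2 + it)|²` at a complex point `η` near
`0`: it saves half a power of `re η`, up to powers of the ratio `‖η‖ / re η`. -/
theorem exists_norm_laplace_zeta_sq_sub_le :
    ∃ C : ℝ, 0 ≤ C ∧ ∀ η : ℂ, 0 < η.re → ‖η‖ ≤ 1 / 4 →
      ‖(∫ t in Ioi (0 : ℝ), ((‖riemannZeta (criticalPoint t)‖ ^ 2 : ℝ) : ℂ) * cexp (-(η * t))) -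
        (Real.eulerMascheroniConstant - log (2 * Real.pi * η)) / η‖ ≤
      C * (η.re ^ (-(1 / 2) : ℝ) * (‖η‖ / η.re) ^ 3) := by
  refine ⟨200 + 2 * (4800 * 512) + 2 * (2 * Real.pi * 20) + 100, by positivity,
    fun η h0 hη => ?_⟩
  have hpi4 := Real.pi_lt_d2
  have hpi3 := Real.pi_gt_three
  obtain ⟨q, w, hwq, hz, hq1, hwδ⟩ := exists_two_pi_I_mul_exp_eq h0 hη
  have hδη : η.re ≤ ‖η‖ := re_le_norm η
  have hη0 : 0 < ‖η‖ := h0.trans_le hδη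
  have hD1 : 1 ≤ η.re ^ (-(1 / 2) : ℝ) :=
    Real.one_le_rpow_of_pos_of_le_one_of_nonpos h0 (by linarith) (by norm_num)
  have hratio : 1 ≤ (‖η‖ / η.re) ^ 3 := one_le_pow₀ ((one_le_div h0).mpr hδη)
  -- The common bound is kept opaque, all error terms being compared with it linearly.
  obtain ⟨E, hE⟩ : ∃ E, E = η.re ^ (-(1 / 2) : ℝ) * (‖η‖ / η.re) ^ 3 := ⟨_, rfl⟩
  have hDE : η.re ^ (-(1 / 2) : ℝ) ≤ E := hE ▸ le_mul_of_one_le_right (by positivity) hratio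
  have hE1 : 1 ≤ E := hD1.trans hDE
  have hqn : 3 / 4 ≤ ‖q‖ ∧ ‖q‖ ≤ 5 / 4 := by
    have h1 := norm_sub_norm_le (1 : ℂ) q
    have h2 := norm_sub_norm_le q (1 : ℂ)
    rw [norm_sub_rev, norm_one] at h1
    rw [norm_one] at h2
    constructor <;> linarith
  have hwn : ‖w‖ = 2 * Real.pi * ‖η‖ * ‖q‖ := by
    rw [hwq]
    simp [abs_of_pos Real.pi_pos]
  have hwlo : ‖η‖ ≤ ‖w‖ := by
    rw [hwn]
    nlinarith [mul_le_mul_of_nonneg_left hqn.1 (mul_pos hη0 Real.pi_pos).le]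
  have hwhi : ‖w‖ ≤ 8 * ‖η‖ := by
    rw [hwn]
    nlinarith [mul_le_mul_of_nonneg_left hqn.2 (mul_pos hη0 Real.pi_pos).le]
  have hw0 : 0 < w.re := h0.trans_le hwδ
  have hmain := norm_laplace_zeta_sq_sub_le h0 (by linarith)
  rw [hz, zetaSqMellin_add_two_pi_I hw0] at hmain
  have hK : ‖zetaSqMellin w‖ ≤ 4800 * 512 * E := by
    refine (norm_zetaSqMellin_le hw0).trans ?_
    have h1 : ‖w‖ ^ (-(1 / 2) : ℝ) ≤ η.re ^ (-(1 / 2) : ℝ) :=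
      Real.rpow_le_rpow_of_nonpos h0 (hδη.trans hwlo) (by norm_num)
    have h2 : ‖w‖ / w.re ≤ 8 * (‖η‖ / η.re) := by
      rw [← mul_div_assoc]
      exact div_le_div₀ (by positivity) hwhi h0 hwδ
    calc 4800 * (‖w‖ ^ (-(1 / 2) : ℝ) * (‖w‖ / w.re) ^ 3)
        ≤ 4800 * (η.re ^ (-(1 / 2) : ℝ) * (8 * (‖η‖ / η.re)) ^ 3) := by gcongr
      _ = _ := by rw [hE]; ring
  have hB := norm_euler_sub_log_div_le (w := w) (by linarith)
  have hyn : ‖-(I * η / 2)‖ = ‖η‖ / 2 := by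
    rw [norm_neg, norm_div, norm_mul, norm_I, one_mul, Complex.norm_ofNat]
  have hy1 : ‖cexp (-(I * η / 2)) - 1‖ ≤ ‖η‖ := by
    refine (norm_exp_sub_one_le (by rw [hyn]; linarith)).trans_eq ?_
    rw [hyn]; ring
  have hdiff := norm_main_term_sub_le h0 hη hq1 hy1 hE1
    ((norm_euler_sub_log_two_pi_mul_le h0 hη).trans (by gcongr))
  rw [← hwq] at hdiff
  rw [← hE]
  generalize cexp (-(I * η / 2)) = c at *
  have hc2 : ‖c‖ ≤ 2 := by
    have := norm_sub_norm_le c 1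
    rw [norm_one] at this
    linarith
  generalize (Real.eulerMascheroniConstant - log (w + 2 * Real.pi * I)) / (w + 2 * Real.pi * I) = B
    at *
  generalize ((Real.eulerMascheroniConstant : ℂ) - log w) / w = A at *
  generalize ((Real.eulerMascheroniConstant : ℂ) - log (2 * Real.pi * η)) / η = M at *
  generalize ∫ t in Ioi (0 : ℝ), ((‖riemannZeta (criticalPoint t)‖ ^ 2 : ℝ) : ℂ) *
    cexp (-(η * t)) = L at *
  generalize zetaSqMellin w = K at *
  have hsplit : L - M = (L - c * (K + 2 * Real.pi * (A - B))) + c * K - c * (2 * Real.pi * B) +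
      (c * (2 * Real.pi * A) - M) := by ring
  have h1 : ‖c * K‖ ≤ 2 * (4800 * 512 * E) := by
    rw [norm_mul]; gcongr
  have h2 : ‖c * (2 * Real.pi * B)‖ ≤ 2 * (2 * Real.pi * 20) := by
    rw [norm_mul, norm_mul, norm_mul, norm_real, Real.norm_of_nonneg Real.pi_pos.le,
      Complex.norm_ofNat]
    gcongr
  rw [hsplit]
  refine (norm_add_le _ _).trans ((add_le_add ((norm_sub_le _ _).trans
    (add_le_add ((norm_add_le _ _).trans (add_le_add hmain h1)) h2)) hdiff).trans ?_)
  nlinarith [mul_nonneg Real.pi_pos.le (sub_nonneg.mpr hE1)]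

/-! ### The excess of the squared zeta function over its mean density -/

/-- The difference between `|ζ(1/2 + it)|²` and the density `log (t / 2π) + 2γ` of its integral. -/
noncomputable def zetaSqExcess (t : ℝ) : ℝ :=
  ‖riemannZeta (criticalPoint t)‖ ^ 2 - Real.log t +
    (Real.log (2 * Real.pi) - 2 * Real.eulerMascheroniConstant)

theorem measurable_zetaSqExcess : Measurable zetaSqExcess := by
  unfold zetaSqExcess
  have := continuous_riemannZeta_criticalPoint.measurable
  have := Real.measurable_log
  fun_prop

/-- The constant in the definition of the excess is the one for which the Laplace transforms of the
logarithm and of the constant cancel the main term of that of `|ζ|²`. -/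
theorem laplace_zetaSqExcess {η : ℂ} (h0 : 0 < η.re) :
    IntegrableOn (fun t : ℝ => (zetaSqExcess t : ℂ) * cexp (-(η * t))) (Ioi 0) ∧
    ∫ t in Ioi (0 : ℝ), (zetaSqExcess t : ℂ) * cexp (-(η * t)) =
      (∫ t in Ioi (0 : ℝ), ((‖riemannZeta (criticalPoint t)‖ ^ 2 : ℝ) : ℂ) * cexp (-(η * t))) -
        (Real.eulerMascheroniConstant - log (2 * Real.pi * η)) / η := by
  have hη : η ≠ 0 := by rintro rfl; simp at h0
  obtain ⟨hl1, hl2⟩ := integral_log_mul_exp_neg_mul h0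
  have hz := integrable_zeta_sq_mul_exp h0
  have he1 : IntegrableOn (fun t : ℝ => cexp (-η * t)) (Ioi 0) :=
    integrableOn_exp_mul_complex_Ioi (by simpa using h0) 0
  have he2 : ∫ t in Ioi (0 : ℝ), cexp (-η * t) = 1 / η := by
    rw [integral_exp_mul_complex_Ioi (by simpa using h0)]
    simp
  set c : ℂ := ((Real.log (2 * Real.pi) - 2 * Real.eulerMascheroniConstant : ℝ) : ℂ) with hc
  have heq : (fun t : ℝ => (zetaSqExcess t : ℂ) * cexp (-(η * t))) = fun t : ℝ =>
      (((‖riemannZeta (criticalPoint t)‖ ^ 2 : ℝ) : ℂ) * cexp (-(η * t)) -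
        (Real.log t : ℂ) * cexp (-(η * t))) + c * cexp (-η * t) := by
    funext t
    rw [zetaSqExcess, hc]
    push_cast
    ring_nf
  have hzl : IntegrableOn (fun t : ℝ =>
      ((‖riemannZeta (criticalPoint t)‖ ^ 2 : ℝ) : ℂ) * cexp (-(η * t)) -
        (Real.log t : ℂ) * cexp (-(η * t))) (Ioi 0) := hz.sub hl1
  have hce := he1.const_mul c
  rw [heq]
  refine ⟨hzl.add hce, ?_⟩
  have h2pi : log (2 * Real.pi * η) = Real.log (2 * Real.pi) + log η := by
    have := log_ofReal_mul (r := 2 * Real.pi) (by positivity) hη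
    push_cast at this ⊢
    exact this
  rw [integral_add hzl hce, integral_sub hz hl1, hl2, integral_const_mul, he2, h2pi, hc]
  push_cast
  field_simp
  ring

theorem abs_log_le_rpow_add_rpow {t : ℝ} (ht : 0 < t) :
    |Real.log t| ≤ 10 * (t ^ (1 / 10 : ℝ) + t ^ (-(1 / 10) : ℝ)) := by
  have h1 := Real.log_le_rpow_div ht.le (by norm_num : (0 : ℝ) < 1 / 10)
  have h2 := Real.log_le_rpow_div (inv_pos.mpr ht).le (by norm_num : (0 : ℝ) < 1 / 10)
  rw [Real.log_inv, Real.inv_rpow ht.le, ← Real.rpow_neg ht.le] at h2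
  have h3 : 0 < t ^ (1 / 10 : ℝ) := by positivity
  have h4 : 0 < t ^ (-(1 / 10) : ℝ) := by positivity
  rw [abs_le]
  constructor <;> linarith

theorem log_two_pi_sub_two_mul_euler_pos :
    0 < Real.log (2 * Real.pi) - 2 * Real.eulerMascheroniConstant := by
  have hγ1 := Real.eulerMascheroniConstant_lt_two_thirds
  have h1 : Real.exp (4 / 3) ≤ 2 * Real.pi := by
    have h2 := Real.exp_one_lt_d9
    have h3 : Real.exp (4 / 3) = Real.exp 1 * Real.exp (1 / 3) := by
      rw [← Real.exp_add]; norm_num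
    have h4 : Real.exp (1 / 3) ≤ 3 / 2 := by
      have := Real.exp_bound_div_one_sub_of_interval (x := 1 / 3) (by norm_num) (by norm_num)
      linarith
    nlinarith [Real.pi_gt_three, Real.exp_pos (1 / 3), Real.exp_pos 1, Real.pi_gt_d2]
  have h5 := (Real.le_log_iff_exp_le (by positivity)).mpr h1
  linarith

/-- The absolute value of the excess exceeds the excess itself by twice its negative part, which is
bounded by a small power of `t` or `1 / t`. -/
theorem exists_integral_abs_zetaSqExcess_le :
    ∃ C : ℝ, 0 ≤ C ∧ ∀ δ : ℝ, 0 < δ → δ ≤ 1 / 4 →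
      IntegrableOn (fun t : ℝ => |zetaSqExcess t| * Real.exp (-(δ * t))) (Ioi 0) ∧
      ∫ t in Ioi (0 : ℝ), |zetaSqExcess t| * Real.exp (-(δ * t)) ≤ C * δ ^ (-(11 / 10) : ℝ) := by
  obtain ⟨C, hC0, hC⟩ := exists_norm_laplace_zeta_sq_sub_le
  set c := Real.log (2 * Real.pi) - 2 * Real.eulerMascheroniConstant with hc
  have hc0 : 0 < c := log_two_pi_sub_two_mul_euler_pos
  refine ⟨C + 2 * (10 * (Real.Gamma (11 / 10) + Real.Gamma (9 / 10)) + c), ?_, fun δ h0 h1 => ?_⟩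
  · have := Real.Gamma_pos_of_pos (show (0 : ℝ) < 11 / 10 by norm_num)
    have := Real.Gamma_pos_of_pos (show (0 : ℝ) < 9 / 10 by norm_num)
    positivity
  have hδre : 0 < (δ : ℂ).re := by simpa using h0
  obtain ⟨hi, hL⟩ := laplace_zetaSqExcess hδre
  have hexp : ∀ t : ℝ, cexp (-((δ : ℂ) * t)) = (Real.exp (-(δ * t)) : ℂ) := by
    intro t; push_cast; rfl
  have hnormL : ‖∫ t in Ioi (0 : ℝ), (zetaSqExcess t : ℂ) * cexp (-((δ : ℂ) * t))‖ ≤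
      C * δ ^ (-(1 / 2) : ℝ) := by
    rw [hL]
    have h2 : ‖(δ : ℂ)‖ = δ := by rw [norm_real, Real.norm_of_nonneg h0.le]
    have := hC δ hδre (by rw [h2]; exact h1)
    rwa [h2, ofReal_re, div_self h0.ne', one_pow, mul_one] at this
  have hF : ∫ t in Ioi (0 : ℝ), zetaSqExcess t * Real.exp (-(δ * t)) ≤ C * δ ^ (-(1 / 2) : ℝ) := by
    have h2 : ∫ t in Ioi (0 : ℝ), (zetaSqExcess t : ℂ) * cexp (-((δ : ℂ) * t)) =
        ((∫ t in Ioi (0 : ℝ), zetaSqExcess t * Real.exp (-(δ * t)) : ℝ) : ℂ) := by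
      rw [← integral_complex_ofReal]
      refine integral_congr_ae (Eventually.of_forall fun t => ?_)
      simp only [hexp]
      push_cast
      rfl
    rw [h2, norm_real] at hnormL
    exact (le_abs_self _).trans hnormL
  have hIF : IntegrableOn (fun t : ℝ => zetaSqExcess t * Real.exp (-(δ * t))) (Ioi 0) := by
    have h2 := hi.re
    refine h2.congr (Eventually.of_forall fun t => ?_)
    change ((zetaSqExcess t : ℂ) * cexp (-((δ : ℂ) * t))).re = _
    rw [hexp, ← ofReal_mul, ofReal_re]
  -- The negative part of the excess is at most `|log t|`, hence at most `G`.
  set G : ℝ → ℝ := fun t => 10 * (t ^ (1 / 10 : ℝ) + t ^ (-(1 / 10) : ℝ)) + c with hG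
  have hr1 : IntegrableOn (fun t : ℝ => t ^ (1 / 10 : ℝ) * Real.exp (-(δ * t))) (Ioi 0) := by
    simpa [neg_mul] using integrableOn_rpow_mul_exp_neg_mul_rpow (p := 1) (s := 1 / 10) (b := δ)
      (by norm_num) one_pos h0
  have hr2 : IntegrableOn (fun t : ℝ => t ^ (-(1 / 10) : ℝ) * Real.exp (-(δ * t))) (Ioi 0) := by
    simpa [neg_mul] using integrableOn_rpow_mul_exp_neg_mul_rpow (p := 1) (s := -(1 / 10)) (b := δ)
      (by norm_num) one_pos h0
  have hr3 : IntegrableOn (fun t : ℝ => Real.exp (-(δ * t))) (Ioi 0) := by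
    simpa [neg_mul] using integrableOn_exp_mul_Ioi (neg_lt_zero.mpr h0) 0
  have hGe : (fun t => G t * Real.exp (-(δ * t))) = fun t : ℝ =>
      10 * (t ^ (1 / 10 : ℝ) * Real.exp (-(δ * t)) + t ^ (-(1 / 10) : ℝ) * Real.exp (-(δ * t))) +
        c * Real.exp (-(δ * t)) := by
    funext t
    simp only [hG]
    ring
  have hr12 : IntegrableOn (fun t : ℝ => t ^ (1 / 10 : ℝ) * Real.exp (-(δ * t)) +
      t ^ (-(1 / 10) : ℝ) * Real.exp (-(δ * t))) (Ioi 0) := hr1.add hr2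
  have hGi : IntegrableOn (fun t => G t * Real.exp (-(δ * t))) (Ioi 0) := by
    rw [hGe]
    exact (hr12.const_mul 10).add (hr3.const_mul c)
  have hGint : ∫ t in Ioi (0 : ℝ), G t * Real.exp (-(δ * t)) ≤
      (10 * (Real.Gamma (11 / 10) + Real.Gamma (9 / 10)) + c) * δ ^ (-(11 / 10) : ℝ) := by
    have e1 : ∫ t in Ioi (0 : ℝ), t ^ (1 / 10 : ℝ) * Real.exp (-(δ * t)) =
        δ ^ (-(11 / 10) : ℝ) * Real.Gamma (11 / 10) := by
      have := Real.integral_rpow_mul_exp_neg_mul_Ioi (a := 11 / 10) (by norm_num) h0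
      rw [one_div, Real.inv_rpow h0.le, ← Real.rpow_neg h0.le] at this
      rw [← this]
      norm_num
    have e2 : ∫ t in Ioi (0 : ℝ), t ^ (-(1 / 10) : ℝ) * Real.exp (-(δ * t)) =
        δ ^ (-(9 / 10) : ℝ) * Real.Gamma (9 / 10) := by
      have := Real.integral_rpow_mul_exp_neg_mul_Ioi (a := 9 / 10) (by norm_num) h0
      rw [one_div, Real.inv_rpow h0.le, ← Real.rpow_neg h0.le] at this
      rw [← this]
      norm_num
    have e3 : ∫ t in Ioi (0 : ℝ), Real.exp (-(δ * t)) = δ ^ (-1 : ℝ) := by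
      have := integral_exp_mul_Ioi (neg_lt_zero.mpr h0) 0
      simp only [neg_mul, mul_zero, Real.exp_zero] at this
      rw [this, Real.rpow_neg_one]
      field_simp
    have hle : ∀ p : ℝ, -(11 / 10) ≤ p → δ ^ p ≤ δ ^ (-(11 / 10) : ℝ) := fun p hp =>
      Real.rpow_le_rpow_of_exponent_ge h0 (by linarith) hp
    rw [hGe, integral_add (hr12.const_mul 10) (hr3.const_mul c), integral_const_mul,
      integral_add hr1 hr2, integral_const_mul, e1, e2, e3]
    have g1 := Real.Gamma_pos_of_pos (show (0 : ℝ) < 9 / 10 by norm_num)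
    have h4 := mul_le_mul_of_nonneg_right (hle (-(9 / 10)) (by norm_num)) g1.le
    have h5 := mul_le_mul_of_nonneg_left (hle (-1) (by norm_num)) hc0.le
    linarith
  have hIA : IntegrableOn (fun t : ℝ => |zetaSqExcess t| * Real.exp (-(δ * t))) (Ioi 0) := by
    refine hIF.abs.congr (Eventually.of_forall fun t => ?_)
    simp only [abs_mul, Real.abs_exp]
  refine ⟨hIA, ?_⟩
  have hpt : ∀ t ∈ Ioi (0 : ℝ), |zetaSqExcess t| * Real.exp (-(δ * t)) ≤
      zetaSqExcess t * Real.exp (-(δ * t)) + 2 * (G t * Real.exp (-(δ * t))) := by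
    intro t ht
    have h2 := abs_log_le_rpow_add_rpow ht
    have h3 : |zetaSqExcess t| ≤ zetaSqExcess t + 2 * G t := by
      have h4 : 0 ≤ ‖riemannZeta (criticalPoint t)‖ ^ 2 := by positivity
      have h5 := abs_le.mp h2
      have h6 := h5.1
      have h7 := h5.2
      rw [abs_le]
      simp only [zetaSqExcess, hG, ← hc]
      constructor <;> linarith
    have h6 := mul_le_mul_of_nonneg_right h3 (Real.exp_pos (-(δ * t))).le
    linarith
  have hmono := setIntegral_mono_on hIA (hIF.add (hGi.const_mul 2)) measurableSet_Ioi hpt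
  refine hmono.trans ?_
  have hadd := integral_add (μ := volume.restrict (Ioi (0 : ℝ))) hIF (hGi.const_mul 2)
  simp only [Pi.add_apply]
  rw [hadd, integral_const_mul]
  have h8 : δ ^ (-(1 / 2) : ℝ) ≤ δ ^ (-(11 / 10) : ℝ) :=
    Real.rpow_le_rpow_of_exponent_ge h0 (by linarith) (by norm_num)
  have h9 := mul_le_mul_of_nonneg_left h8 hC0
  linarith

/-- Two bounds for the Laplace transform of the excess: one good near the real axis, the other
uniform in the imaginary part. -/
theorem exists_norm_laplace_zetaSqExcess_le :
    ∃ C : ℝ, 0 ≤ C ∧ ∀ η : ℂ, 0 < η.re → η.re ≤ 1 / 4 →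
      ‖∫ t in Ioi (0 : ℝ), (zetaSqExcess t : ℂ) * cexp (-(η * t))‖ ≤
        C * η.re ^ (-(7 / 2) : ℝ) * ‖η‖ ^ 3 ∧
      ‖∫ t in Ioi (0 : ℝ), (zetaSqExcess t : ℂ) * cexp (-(η * t))‖ ≤
        C * η.re ^ (-(11 / 10) : ℝ) := by
  obtain ⟨C₁, hC₁0, hC₁⟩ := exists_norm_laplace_zeta_sq_sub_le
  obtain ⟨C₂, hC₂0, hC₂⟩ := exists_integral_abs_zetaSqExcess_le
  refine ⟨C₁ + 64 * C₂, by positivity, fun η h0 h1 => ?_⟩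
  have hP : ‖∫ t in Ioi (0 : ℝ), (zetaSqExcess t : ℂ) * cexp (-(η * t))‖ ≤
      C₂ * η.re ^ (-(11 / 10) : ℝ) := by
    obtain ⟨hi, hb⟩ := hC₂ η.re h0 h1
    refine (norm_integral_le_of_norm_le hi (Eventually.of_forall fun t => ?_)).trans hb
    rw [norm_mul, norm_real, norm_exp, Real.norm_eq_abs, neg_re, re_mul_ofReal]
  have hη0 : 0 < ‖η‖ := h0.trans_le (re_le_norm η)
  constructor
  · by_cases hη : ‖η‖ ≤ 1 / 4
    · have h2 := hC₁ η h0 hη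
      rw [← (laplace_zetaSqExcess h0).2] at h2
      refine h2.trans ?_
      have h3 : η.re ^ (-(1 / 2) : ℝ) * (‖η‖ / η.re) ^ 3 = η.re ^ (-(7 / 2) : ℝ) * ‖η‖ ^ 3 := by
        have : η.re ^ (-(7 / 2) : ℝ) = η.re ^ (-(1 / 2) : ℝ) / η.re ^ 3 := by
          rw [← Real.rpow_natCast η.re 3, ← Real.rpow_sub h0]
          norm_num
        rw [this]
        field_simp
      rw [h3, ← mul_assoc]
      gcongr
      linarith
    · refine hP.trans ?_
      have h3 : η.re ^ (-(11 / 10) : ℝ) ≤ η.re ^ (-(7 / 2) : ℝ) :=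
        Real.rpow_le_rpow_of_exponent_ge h0 (by linarith) (by norm_num)
      have h4 : (1 / 4 : ℝ) ^ 3 ≤ ‖η‖ ^ 3 := by
        gcongr
        exact (not_le.mp hη).le
      calc C₂ * η.re ^ (-(11 / 10) : ℝ) ≤ C₂ * η.re ^ (-(7 / 2) : ℝ) := by gcongr
        _ = 64 * C₂ * η.re ^ (-(7 / 2) : ℝ) * (1 / 4) ^ 3 := by ring
        _ ≤ (C₁ + 64 * C₂) * η.re ^ (-(7 / 2) : ℝ) * ‖η‖ ^ 3 := by
          gcongr
          linarith
  · refine hP.trans ?_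
    gcongr
    linarith

/-! ### Twice integrated Laplace inversion -/

theorem norm_sq_ofReal_add_mul_I (δ u : ℝ) : ‖(δ : ℂ) + u * I‖ ^ 2 = δ ^ 2 + u ^ 2 := by
  rw [← normSq_eq_norm_sq, normSq_add_mul_I]

theorem integrable_inv_sq_add_sq {a : ℝ} (ha : 0 < a) :
    Integrable fun u : ℝ => (a ^ 2 + u ^ 2)⁻¹ := by
  have h1 := (integrable_inv_one_add_sq.comp_mul_left' (inv_ne_zero ha.ne')).const_mul (a ^ 2)⁻¹
  refine h1.congr (Eventually.of_forall fun u => ?_)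
  simp only
  rw [← mul_inv]
  congr 1
  field_simp

theorem integral_univ_inv_sq_add_sq {a : ℝ} (ha : 0 < a) :
    ∫ u : ℝ, (a ^ 2 + u ^ 2)⁻¹ = Real.pi / a := by
  have h1 := Measure.integral_comp_mul_left (fun x : ℝ => (1 + x ^ 2)⁻¹) a⁻¹
  rw [integral_univ_inv_one_add_sq, inv_inv, abs_of_pos ha, smul_eq_mul] at h1
  have h2 : ∀ u : ℝ, (a ^ 2 + u ^ 2)⁻¹ = (a ^ 2)⁻¹ * (1 + (a⁻¹ * u) ^ 2)⁻¹ := by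
    intro u
    rw [← mul_inv]
    congr 1
    field_simp
  simp_rw [h2]
  rw [integral_const_mul, h1]
  field_simp

/-- The Perron formula for the kernel `max x 0`, by Fourier inversion. -/
theorem integral_exp_div_sq {δ : ℝ} (hδ : 0 < δ) (x : ℝ) :
    ∫ u : ℝ, cexp (((δ : ℂ) + u * I) * x) / ((δ : ℂ) + u * I) ^ 2 =
      2 * Real.pi * ((max x 0 : ℝ) : ℂ) := by
  set h : ℝ → ℂ := fun x => ((max x 0 : ℝ) : ℂ) * cexp (-(δ * x)) with hh
  have hc : Continuous h := by rw [hh]; fun_prop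
  have hpos : ∀ x : ℝ, 0 < x → h x = (x : ℂ) ^ ((2 : ℂ) - 1) * cexp (-(δ * x)) := by
    intro x hx
    have : (2 : ℂ) - 1 = 1 := by norm_num
    rw [hh, this, cpow_one]
    simp only
    rw [max_eq_left hx.le]
  have hneg : ∀ x : ℝ, x ∉ Ioi 0 → h x = 0 := by
    intro x hx
    simp only [hh]
    rw [max_eq_right (not_lt.mp hx)]
    simp
  have hint : Integrable h := by
    have h1 : IntegrableOn (fun x : ℝ => x ^ (1 : ℝ) * Real.exp (-δ * x)) (Ioi 0) := by
      simpa using integrableOn_rpow_mul_exp_neg_mul_rpow (p := 1) (s := 1) (b := δ)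
        (by norm_num) one_pos hδ
    have h2 : IntegrableOn h (Ioi 0) := by
      refine h1.mono' hc.aestronglyMeasurable ?_
      refine (ae_restrict_mem measurableSet_Ioi).mono fun x hx => ?_
      have hx0 : (0 : ℝ) < x := hx
      simp only [hh]
      rw [max_eq_left hx0.le, norm_mul, norm_real, Real.norm_of_nonneg hx0.le, norm_exp,
        Real.rpow_one]
      simp
    refine (integrableOn_iff_integrable_of_support_subset fun x hx => ?_).mp h2
    by_contra hx0
    exact hx (hneg x hx0)
  have hF : ∀ ξ : ℝ, FourierTransform.fourier h ξ =
      1 / ((δ : ℂ) + (2 * Real.pi * ξ : ℝ) * I) ^ 2 := by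
    intro ξ
    have hre : 0 < ((δ : ℂ) + (2 * Real.pi * ξ : ℝ) * I).re := by
      rw [add_re, re_ofReal_mul, ofReal_re, I_re, mul_zero, add_zero]
      exact hδ
    have h1 := integral_cpow_mul_exp_neg_complex_mul (a := 2) (by simp) hre
    have hG : Gamma 2 = 1 := by
      simp
    rw [hG, mul_one, cpow_neg, cpow_ofNat] at h1
    rw [one_div, ← h1, Real.fourier_eq', ← integral_indicator measurableSet_Ioi]
    refine integral_congr_ae (Eventually.of_forall fun x => ?_)
    by_cases hx : x ∈ Ioi (0 : ℝ)
    · simp only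
      rw [indicator_of_mem hx, hpos x hx, smul_eq_mul, mul_left_comm, ← Complex.exp_add]
      congr 2
      simp only [RCLike.inner_apply, conj_trivial]
      push_cast
      ring
    · simp only
      rw [indicator_of_notMem hx, hneg x hx, smul_zero]
  have hFint : Integrable (FourierTransform.fourier h) := by
    have h1 := (integrable_inv_sq_add_sq hδ).comp_mul_left' (R := 2 * Real.pi) (by positivity)
    refine h1.mono' ?_ (Eventually.of_forall fun ξ => ?_)
    · rw [show FourierTransform.fourier h = fun ξ : ℝ =>
        1 / ((δ : ℂ) + (2 * Real.pi * ξ : ℝ) * I) ^ 2 from funext hF]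
      exact (by fun_prop : Measurable fun ξ : ℝ =>
        1 / ((δ : ℂ) + (2 * Real.pi * ξ : ℝ) * I) ^ 2).aestronglyMeasurable
    · rw [hF, norm_div, norm_one, norm_pow, norm_sq_ofReal_add_mul_I, one_div]
  have hinv := hint.fourierInv_fourier_eq hFint (v := x) hc.continuousAt
  rw [Real.fourierInv_eq'] at hinv
  have hsub := Measure.integral_comp_mul_left
    (fun u : ℝ => cexp ((u : ℂ) * x * I) / ((δ : ℂ) + u * I) ^ 2) (2 * Real.pi)
  rw [abs_of_pos (by positivity), real_smul] at hsub
  have h3 : ∫ ξ : ℝ, cexp (((2 * Real.pi * inner ℝ ξ x : ℝ) : ℂ) * I) •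
      FourierTransform.fourier h ξ = ∫ ξ : ℝ, cexp (((2 * Real.pi * ξ : ℝ) : ℂ) * x * I) /
        ((δ : ℂ) + (2 * Real.pi * ξ : ℝ) * I) ^ 2 := by
    refine integral_congr_ae (Eventually.of_forall fun ξ => ?_)
    simp only
    rw [hF, smul_eq_mul, mul_one_div]
    congr 2
    simp only [RCLike.inner_apply, conj_trivial]
    push_cast
    ring
  rw [h3, hsub] at hinv
  have hpi : (Real.pi : ℂ) ≠ 0 := ofReal_ne_zero.mpr Real.pi_ne_zero
  have h4 : ∀ u : ℝ, cexp (((δ : ℂ) + u * I) * x) / ((δ : ℂ) + u * I) ^ 2 =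
      cexp (δ * x) * (cexp ((u : ℂ) * x * I) / ((δ : ℂ) + u * I) ^ 2) := by
    intro u
    rw [← mul_div_assoc, ← Complex.exp_add]
    ring_nf
  simp_rw [h4]
  rw [integral_const_mul]
  have h5 : ∫ u : ℝ, cexp ((u : ℂ) * x * I) / ((δ : ℂ) + u * I) ^ 2 = 2 * Real.pi * h x := by
    rw [← hinv]
    generalize ∫ u : ℝ, cexp ((u : ℂ) * x * I) / ((δ : ℂ) + u * I) ^ 2 = J
    push_cast
    field_simp
  rw [h5, hh]
  simp only
  have h6 : cexp (δ * x) * cexp (-(δ * x)) = 1 := by rw [← Complex.exp_add]; simp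
  linear_combination (2 * Real.pi * ((max x 0 : ℝ) : ℂ)) * h6

/-- A twice integrated Laplace inversion formula, requiring only absolute convergence of the Laplace
integral on the line of integration. -/
theorem integral_laplace_mul_exp_div_sq {F : ℝ → ℝ} (hFm : Measurable F) {δ : ℝ} (hδ : 0 < δ)
    (hF : IntegrableOn (fun t : ℝ => |F t| * Real.exp (-(δ * t))) (Ioi 0)) (T : ℝ) :
    ∫ u : ℝ, (∫ t in Ioi (0 : ℝ), (F t : ℂ) * cexp (-(((δ : ℂ) + u * I) * t))) *
        (cexp (((δ : ℂ) + u * I) * T) / ((δ : ℂ) + u * I) ^ 2) =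
      2 * Real.pi * ((∫ t in Ioi (0 : ℝ), F t * max (T - t) 0 : ℝ) : ℂ) := by
  have hne : ∀ u : ℝ, (δ : ℂ) + u * I ≠ 0 := by
    intro u h
    have := congrArg Complex.re h
    simp at this
    exact hδ.ne' this
  set k : ℝ → ℂ := fun u => cexp (((δ : ℂ) + u * I) * T) / ((δ : ℂ) + u * I) ^ 2 with hk
  have hkc : Continuous k := by
    rw [hk]
    refine Continuous.div (by fun_prop) (by fun_prop) fun u => pow_ne_zero 2 (hne u)
  have hknorm : ∀ u, ‖k u‖ = Real.exp (δ * T) * (δ ^ 2 + u ^ 2)⁻¹ := by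
    intro u
    simp only [hk]
    rw [norm_div, norm_pow, norm_sq_ofReal_add_mul_I, norm_exp, div_eq_mul_inv]
    simp
  have hkint : Integrable k := by
    refine ((integrable_inv_sq_add_sq hδ).const_mul (Real.exp (δ * T))).mono'
      hkc.aestronglyMeasurable (Eventually.of_forall fun u => (hknorm u).le)
  set g : ℝ × ℝ → ℂ := fun p => (F p.2 : ℂ) * cexp (-(((δ : ℂ) + p.1 * I) * p.2)) * k p.1 with hg
  have hgm : Measurable g := by
    have h1 : Measurable fun p : ℝ × ℝ => (F p.2 : ℂ) :=
      measurable_ofReal.comp (hFm.comp measurable_snd)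
    have h2 : Continuous fun p : ℝ × ℝ => cexp (-(((δ : ℂ) + p.1 * I) * p.2)) := by fun_prop
    exact (h1.mul h2.measurable).mul (hkc.measurable.comp measurable_fst)
  have hprod : Integrable g ((volume : Measure ℝ).prod (volume.restrict (Ioi (0 : ℝ)))) := by
    refine (hkint.norm.mul_prod hF).mono' hgm.aestronglyMeasurable
      (Eventually.of_forall fun p => ?_)
    simp only [hg]
    rw [norm_mul, norm_mul, norm_real, Real.norm_eq_abs, norm_exp, mul_comm]
    simp
  have h1 : ∫ u : ℝ, (∫ t in Ioi (0 : ℝ), (F t : ℂ) * cexp (-(((δ : ℂ) + u * I) * t))) * k u =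
      ∫ u : ℝ, ∫ t in Ioi (0 : ℝ), g (u, t) := by
    refine integral_congr_ae (Eventually.of_forall fun u => ?_)
    simp only [hg]
    rw [integral_mul_const]
  rw [h1, integral_integral_swap (f := fun u t => g (u, t)) hprod, ← integral_complex_ofReal,
    ← integral_const_mul]
  refine integral_congr_ae (Eventually.of_forall fun t => ?_)
  simp only [hg, hk]
  have h2 : ∀ u : ℝ, (F t : ℂ) * cexp (-(((δ : ℂ) + u * I) * t)) *
      (cexp (((δ : ℂ) + u * I) * T) / ((δ : ℂ) + u * I) ^ 2) =
      F t * (cexp (((δ : ℂ) + u * I) * (T - t : ℝ)) / ((δ : ℂ) + u * I) ^ 2) := by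
    intro u
    have : cexp (((δ : ℂ) + u * I) * (T - t : ℝ)) =
        cexp (-(((δ : ℂ) + u * I) * t)) * cexp (((δ : ℂ) + u * I) * T) := by
      rw [← Complex.exp_add]
      push_cast
      ring_nf
    rw [this]
    ring
  simp_rw [h2]
  rw [integral_const_mul, integral_exp_div_sq hδ]
  push_cast
  ring

/-! ### The Tauberian argument -/

theorem intervalIntegrable_zetaSqExcess (a b : ℝ) :
    IntervalIntegrable zetaSqExcess volume a b := by
  have h1 := continuous_riemannZeta_criticalPoint
  exact ((Continuous.intervalIntegrable (by fun_prop : Continuous fun t =>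
    ‖riemannZeta (criticalPoint t)‖ ^ 2) a b).sub
      intervalIntegral.intervalIntegrable_log').add intervalIntegrable_const

theorem intervalIntegrable_sub_mul_zetaSqExcess (c a b : ℝ) :
    IntervalIntegrable (fun t => (c - t) * zetaSqExcess t) volume a b :=
  (intervalIntegrable_zetaSqExcess a b).continuousOn_mul (by fun_prop)

theorem integral_Ioi_mul_max_eq {F : ℝ → ℝ} {T : ℝ} (hT : 0 ≤ T) :
    ∫ t in Ioi (0 : ℝ), F t * max (T - t) 0 = ∫ t in (0 : ℝ)..T, (T - t) * F t := by
  rw [intervalIntegral.integral_of_le hT, ← integral_indicator measurableSet_Ioi,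
    ← integral_indicator measurableSet_Ioc]
  refine integral_congr_ae (Eventually.of_forall fun t => ?_)
  by_cases h0 : 0 < t
  · by_cases h1 : t ≤ T
    · rw [indicator_of_mem (show t ∈ Ioi 0 from h0),
        indicator_of_mem (show t ∈ Ioc 0 T from ⟨h0, h1⟩), max_eq_left (by linarith), mul_comm]
    · rw [indicator_of_mem (show t ∈ Ioi 0 from h0), indicator_of_notMem (fun h => h1 h.2),
        max_eq_right (by linarith), mul_zero]
  · rw [indicator_of_notMem (show t ∉ Ioi 0 from h0), indicator_of_notMem (fun h => h0 h.1)]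

/-- A quantity bounded both by `A ‖η‖ ^ 3` and by `B`, where `η = δ + i u`, becomes after division
by `‖η‖ ^ 2` at most a multiple of the integrable function `1 / (U ^ 2 + u ^ 2)`: the first bound
serves for `|u| ≤ U` and the second elsewhere. -/
theorem le_div_sq_add_sq_of_le {x A B U δ u : ℝ} (hδU : δ ≤ U) (h0 : 0 < δ)
    (hA0 : 0 ≤ A) (hB0 : 0 ≤ B)
    (hA : x ≤ A * ‖(δ : ℂ) + u * I‖ ^ 3) (hB : x ≤ B) :
    x * (‖(δ : ℂ) + u * I‖ ^ 2)⁻¹ ≤ (4 * A * U ^ 3 + 2 * B) * (U ^ 2 + u ^ 2)⁻¹ := by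
  have hU0 : 0 < U := h0.trans_le hδU
  have hn2 := norm_sq_ofReal_add_mul_I δ u
  have hnpos : 0 < ‖(δ : ℂ) + u * I‖ ^ 2 := by rw [hn2]; positivity
  rw [← div_eq_mul_inv, ← div_eq_mul_inv, div_le_div_iff₀ hnpos (by positivity)]
  by_cases hu : |u| ≤ U
  · have hu2 : u ^ 2 ≤ U ^ 2 := sq_le_sq' (by linarith [(abs_le.mp hu).1]) (abs_le.mp hu).2
    have h1 : ‖(δ : ℂ) + u * I‖ ≤ 2 * U := by
      refine (norm_add_le _ _).trans ?_
      rw [norm_mul, norm_I, mul_one, norm_real, norm_real, Real.norm_of_nonneg h0.le,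
        Real.norm_eq_abs]
      linarith
    calc x * (U ^ 2 + u ^ 2) ≤ A * ‖(δ : ℂ) + u * I‖ ^ 3 * (2 * U ^ 2) := by
          refine mul_le_mul hA (by linarith) (by positivity) (by positivity)
      _ = A * (2 * U ^ 2) * ‖(δ : ℂ) + u * I‖ ^ 2 * ‖(δ : ℂ) + u * I‖ := by ring
      _ ≤ A * (2 * U ^ 2) * ‖(δ : ℂ) + u * I‖ ^ 2 * (2 * U) := by gcongr
      _ = (4 * A * U ^ 3) * ‖(δ : ℂ) + u * I‖ ^ 2 := by ring
      _ ≤ _ := by gcongr; linarith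
  · have hu2 : U ^ 2 ≤ u ^ 2 := by
      rw [← sq_abs u]
      exact pow_le_pow_left₀ hU0.le (not_le.mp hu).le 2
    calc x * (U ^ 2 + u ^ 2) ≤ B * (2 * u ^ 2) := by
          refine mul_le_mul hB (by linarith) (by positivity) hB0
      _ = 2 * B * u ^ 2 := by ring
      _ ≤ 2 * B * ‖(δ : ℂ) + u * I‖ ^ 2 := by
          rw [hn2]; gcongr; linarith [sq_nonneg δ]
      _ ≤ _ := by
          gcongr
          have : 0 ≤ A * U ^ 3 := by positivity
          linarith

/-- A power saving for the second primitive of the excess, by Laplace inversion on the line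
`re η = 1 / T`. -/
theorem exists_abs_integral_sub_mul_zetaSqExcess_le :
    ∃ C : ℝ, 0 ≤ C ∧ ∀ T : ℝ, 4 ≤ T →
      |∫ t in (0 : ℝ)..T, (T - t) * zetaSqExcess t| ≤ C * T ^ (19 / 10 : ℝ) := by
  obtain ⟨C, hC0, hC⟩ := exists_norm_laplace_zetaSqExcess_le
  obtain ⟨C₂, -, hC₂⟩ := exists_integral_abs_zetaSqExcess_le
  refine ⟨Real.exp 1 * (3 * C), by positivity, fun T hT => ?_⟩
  have hT0 : 0 < T := by linarith
  set δ := T⁻¹ with hδ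
  have hδ0 : 0 < δ := inv_pos.mpr hT0
  have hδ1 : δ ≤ 1 / 4 := by
    rw [hδ, inv_eq_one_div]
    exact one_div_le_one_div_of_le (by norm_num) hT
  have hδT : δ * T = 1 := inv_mul_cancel₀ hT0.ne'
  -- The threshold for `|im η|` at which the two bounds contribute equally.
  set U := δ ^ (4 / 5 : ℝ) with hU
  have hU0 : 0 < U := Real.rpow_pos_of_pos hδ0 _
  have hδU : δ ≤ U := by
    have := Real.rpow_le_rpow_of_exponent_ge hδ0 (by linarith) (show (4 / 5 : ℝ) ≤ 1 by norm_num)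
    rwa [Real.rpow_one] at this
  set A := C * δ ^ (-(7 / 2) : ℝ) with hA
  set B := C * δ ^ (-(11 / 10) : ℝ) with hB
  have hA0 : 0 ≤ A := by positivity
  have hB0 : 0 ≤ B := by positivity
  have hform := integral_laplace_mul_exp_div_sq measurable_zetaSqExcess hδ0
    (hC₂ δ hδ0 hδ1).1 T
  rw [integral_Ioi_mul_max_eq hT0.le] at hform
  have hbound := norm_integral_le_of_norm_le
    (f := fun u : ℝ => (∫ t in Ioi (0 : ℝ), (zetaSqExcess t : ℂ) *
      cexp (-(((δ : ℂ) + u * I) * t))) * (cexp (((δ : ℂ) + u * I) * T) / ((δ : ℂ) + u * I) ^ 2))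
    (((integrable_inv_sq_add_sq hU0).const_mul (4 * A * U ^ 3 + 2 * B)).const_mul (Real.exp 1))
    (Eventually.of_forall fun u => by
      have hre : ((δ : ℂ) + u * I).re = δ := by simp
      obtain ⟨h1, h2⟩ := hC ((δ : ℂ) + u * I) (by rw [hre]; exact hδ0) (by rw [hre]; exact hδ1)
      rw [hre] at h1 h2
      have h3 := le_div_sq_add_sq_of_le hδU hδ0 hA0 hB0 h1 h2
      have h4 : ‖cexp (((δ : ℂ) + u * I) * T)‖ = Real.exp 1 := by
        rw [norm_exp, re_mul_ofReal, hre, hδT]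
      rw [norm_mul, norm_div, norm_pow, h4, div_eq_mul_inv, mul_left_comm]
      exact mul_le_mul_of_nonneg_left h3 (Real.exp_pos 1).le)
  rw [hform, integral_const_mul, integral_const_mul, integral_univ_inv_sq_add_sq hU0, norm_mul,
    norm_mul, norm_real, norm_real, Complex.norm_ofNat, Real.norm_of_nonneg Real.pi_pos.le,
    Real.norm_eq_abs] at hbound
  have hp1 : A * U ^ 2 = C * δ ^ (-(19 / 10) : ℝ) := by
    rw [hA, hU, ← Real.rpow_natCast, ← Real.rpow_mul hδ0.le, mul_assoc, ← Real.rpow_add hδ0]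
    norm_num
  have hp2 : B / U = C * δ ^ (-(19 / 10) : ℝ) := by
    rw [hB, hU, mul_div_assoc, ← Real.rpow_sub hδ0]
    norm_num
  have hp3 : δ ^ (-(19 / 10) : ℝ) = T ^ (19 / 10 : ℝ) := by
    rw [hδ, Real.inv_rpow hT0.le, Real.rpow_neg hT0.le, inv_inv]
  have h5 : Real.exp 1 * ((4 * A * U ^ 3 + 2 * B) * (Real.pi / U)) =
      2 * Real.pi * (Real.exp 1 * (3 * C) * T ^ (19 / 10 : ℝ)) := by
    have : (4 * A * U ^ 3 + 2 * B) * (Real.pi / U) = Real.pi * (4 * (A * U ^ 2) + 2 * (B / U)) := by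
      field_simp
    rw [this, hp1, hp2, hp3]
    ring
  rw [h5] at hbound
  exact le_of_mul_le_mul_left hbound (by positivity)

/-- Differencing: the increment of the second primitive is that of its tangent plus a remainder. -/
theorem integral_sub_mul_zetaSqExcess_eq {a b : ℝ} :
    ∫ t in (0 : ℝ)..b, (b - t) * zetaSqExcess t =
      (∫ t in (0 : ℝ)..a, (a - t) * zetaSqExcess t) +
        (b - a) * (∫ t in (0 : ℝ)..a, zetaSqExcess t) +
        ∫ t in a..b, (b - t) * zetaSqExcess t := by
  rw [← intervalIntegral.integral_add_adjacent_intervals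
    (intervalIntegrable_sub_mul_zetaSqExcess b 0 a) (intervalIntegrable_sub_mul_zetaSqExcess b a b),
    ← intervalIntegral.integral_const_mul, ← intervalIntegral.integral_add
      (intervalIntegrable_sub_mul_zetaSqExcess a 0 a)
      ((intervalIntegrable_zetaSqExcess 0 a).const_mul _)]
  congr 2
  funext t
  ring

theorem neg_log_le_zetaSqExcess {t T : ℝ} (ht : 0 < t) (htT : t ≤ T) :
    -Real.log T ≤ zetaSqExcess t := by
  have h1 := Real.log_le_log ht htT
  have h2 := log_two_pi_sub_two_mul_euler_pos
  have h3 : 0 ≤ ‖riemannZeta (criticalPoint t)‖ ^ 2 := by positivity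
  rw [zetaSqExcess]
  linarith

/-- The remainder in the differencing step, forwards and backwards, is bounded below, since the
excess is at least `-log t`. -/
theorem neg_sq_mul_log_le_integral {T h : ℝ} (h0 : 0 < h) (hT : h < T) (hT1 : 1 ≤ T) :
    -(h ^ 2 * Real.log (2 * T)) ≤ ∫ t in T..(T + h), (T + h - t) * zetaSqExcess t ∧
    -(h ^ 2 * Real.log (2 * T)) ≤ ∫ t in T..(T - h), (T - h - t) * zetaSqExcess t := by
  have hlog : 0 ≤ Real.log (2 * T) := Real.log_nonneg (by linarith)
  have key : ∀ c : ℝ, 0 ≤ c → c ≤ h → ∀ t : ℝ, 0 < t → t ≤ 2 * T →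
      -(h * Real.log (2 * T)) ≤ c * zetaSqExcess t := by
    intro c hc0 hc t ht0 ht
    have h1 := mul_le_mul_of_nonneg_left (neg_log_le_zetaSqExcess ht0 ht) hc0
    have h2 := mul_le_mul_of_nonneg_right hc hlog
    linarith
  constructor
  · have h1 := intervalIntegral.integral_mono_on (a := T) (b := T + h) (by linarith)
      intervalIntegrable_const (intervalIntegrable_sub_mul_zetaSqExcess (T + h) T (T + h))
      (fun t ht => key (T + h - t) (by linarith [ht.2]) (by linarith [ht.1]) t
        (by linarith [ht.1]) (by linarith [ht.2]))
    rw [intervalIntegral.integral_const, smul_eq_mul] at h1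
    linarith
  · have h1 := intervalIntegral.integral_mono_on (a := T - h) (b := T)
      (f := fun _ => -(h * Real.log (2 * T)))
      (g := fun t => -((T - h - t) * zetaSqExcess t)) (by linarith)
      intervalIntegrable_const (intervalIntegrable_sub_mul_zetaSqExcess (T - h) (T - h) T).neg
      (fun t ht => by
        have := key (t - (T - h)) (by linarith [ht.1]) (by linarith [ht.2]) t
          (by linarith [ht.1]) (by linarith [ht.2])
        linarith)
    rw [intervalIntegral.integral_const, smul_eq_mul] at h1
    rw [intervalIntegral.integral_symm, ← intervalIntegral.integral_neg]
    linarith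

/-- The mean value of the excess tends to zero. The lower bound `-log t` for the excess allows to
pass from the second primitive to the first. -/
theorem isLittleO_integral_zetaSqExcess :
    (fun T : ℝ => ∫ t in (0 : ℝ)..T, zetaSqExcess t) =o[atTop] fun T : ℝ => T := by
  obtain ⟨C, hC0, hC⟩ := exists_abs_integral_sub_mul_zetaSqExcess_le
  have hbig : (fun T : ℝ => ∫ t in (0 : ℝ)..T, zetaSqExcess t) =O[atTop]
      fun T : ℝ => T ^ (39 / 40 : ℝ) := by
    refine Asymptotics.IsBigO.of_bound (8 * C + 80) ?_
    have hlim : Tendsto (fun T : ℝ => T ^ (-(1 / 20) : ℝ)) atTop (𝓝 0) :=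
      tendsto_rpow_neg_atTop (by norm_num)
    filter_upwards [eventually_ge_atTop 8, hlim.eventually (gt_mem_nhds (show (0 : ℝ) < 1 / 2
      by norm_num))] with T hT8 hTs
    have hT0 : 0 < T := by linarith
    set E := ∫ t in (0 : ℝ)..T, zetaSqExcess t with hE
    -- The step is chosen so that `h²` has the order of the bound for the second primitive.
    set h := T ^ (19 / 20 : ℝ) with hh
    have hh0 : 0 < h := Real.rpow_pos_of_pos hT0 _
    have hhT : h ≤ T / 2 := by
      have h1 : h = T * T ^ (-(1 / 20) : ℝ) := by
        rw [hh, ← Real.rpow_one_add' hT0.le (by norm_num)]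
        norm_num
      rw [h1]
      nlinarith
    have hF : ∀ S : ℝ, T / 2 ≤ S → S ≤ 2 * T →
        |∫ t in (0 : ℝ)..S, (S - t) * zetaSqExcess t| ≤ 4 * C * (h * h) := by
      intro S h1 h2
      have h3 : S ^ (19 / 10 : ℝ) ≤ 4 * (h * h) := by
        have h4 : S ^ (19 / 10 : ℝ) ≤ (2 * T) ^ (19 / 10 : ℝ) :=
          Real.rpow_le_rpow (by linarith) h2 (by norm_num)
        have h5 : (2 : ℝ) ^ (19 / 10 : ℝ) ≤ 4 := by
          have := Real.rpow_le_rpow_of_exponent_le (one_le_two (α := ℝ))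
            (show (19 / 10 : ℝ) ≤ 2 by norm_num)
          norm_num at this ⊢
          exact this
        have h6 : h * h = T ^ (19 / 10 : ℝ) := by
          rw [hh, ← Real.rpow_add hT0]
          norm_num
        rw [Real.mul_rpow (by norm_num) hT0.le, ← h6] at h4
        exact h4.trans (by gcongr)
      calc _ ≤ C * S ^ (19 / 10 : ℝ) := hC S (by linarith)
        _ ≤ C * (4 * (h * h)) := by gcongr
        _ = _ := by ring
    obtain ⟨hlow1, hlow2⟩ := neg_sq_mul_log_le_integral hh0 (by linarith) (by linarith : 1 ≤ T)
    have e1 := integral_sub_mul_zetaSqExcess_eq (a := T) (b := T + h)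
    have e2 := integral_sub_mul_zetaSqExcess_eq (a := T) (b := T - h)
    have b0 := abs_le.mp (hF T (by linarith) (by linarith))
    have b1 := abs_le.mp (hF (T + h) (by linarith) (by linarith))
    have b2 := abs_le.mp (hF (T - h) (by linarith) (by linarith))
    rw [← hE] at e1 e2
    have hlogT : Real.log (2 * T) ≤ 80 * T ^ (1 / 40 : ℝ) := by
      have h1 := Real.log_le_rpow_div (show 0 ≤ 2 * T by linarith)
        (show (0 : ℝ) < 1 / 40 by norm_num)
      have h2 : (2 : ℝ) ^ (1 / 40 : ℝ) ≤ 2 := by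
        have := Real.rpow_le_rpow_of_exponent_le (one_le_two (α := ℝ))
          (show (1 / 40 : ℝ) ≤ 1 by norm_num)
        rwa [Real.rpow_one] at this
      rw [Real.mul_rpow (by norm_num) hT0.le] at h1
      have h3 : 0 ≤ T ^ (1 / 40 : ℝ) := by positivity
      nlinarith
    have hfin : |E| ≤ h * (8 * C + Real.log (2 * T)) := by
      rw [abs_le]
      constructor
      · refine le_of_mul_le_mul_left ?_ hh0
        nlinarith [b0.1, b0.2, b2.1, b2.2]
      · refine le_of_mul_le_mul_left ?_ hh0
        nlinarith [b0.1, b0.2, b1.1, b1.2]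
    have hT1 : 1 ≤ T ^ (1 / 40 : ℝ) := Real.one_le_rpow (by linarith) (by norm_num)
    rw [Real.norm_eq_abs, Real.norm_of_nonneg (by positivity)]
    have hmul : h * T ^ (1 / 40 : ℝ) = T ^ (39 / 40 : ℝ) := by
      rw [hh, ← Real.rpow_add hT0]
      norm_num
    calc |E| ≤ h * (8 * C + Real.log (2 * T)) := hfin
      _ ≤ h * (8 * C * T ^ (1 / 40 : ℝ) + 80 * T ^ (1 / 40 : ℝ)) := by
        have h7 : 8 * C ≤ 8 * C * T ^ (1 / 40 : ℝ) := le_mul_of_one_le_right (by positivity) hT1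
        exact mul_le_mul_of_nonneg_left (add_le_add h7 hlogT) hh0.le
      _ = (8 * C + 80) * (h * T ^ (1 / 40 : ℝ)) := by ring
      _ = _ := by rw [hmul]
  refine hbig.trans_isLittleO ?_
  have hlim : Tendsto (fun T : ℝ => T ^ (-(1 / 40) : ℝ)) atTop (𝓝 0) :=
    tendsto_rpow_neg_atTop (by norm_num)
  refine (Asymptotics.isLittleO_iff_tendsto' ?_).mpr (hlim.congr' ?_)
  · filter_upwards [eventually_gt_atTop 0] with T hT h0
    exact absurd h0 hT.ne'
  · filter_upwards [eventually_gt_atTop 0] with T hT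
    rw [← Real.rpow_sub_one hT.ne']
    norm_num

theorem logHardyLittlewoodIntegral_eq (T : ℝ) :
    logHardyLittlewoodIntegral T =
      (Real.log (2 * Real.pi) - 2 * Real.eulerMascheroniConstant) * T -
        ∫ t in (0 : ℝ)..T, zetaSqExcess t := by
  have h1 : ∫ t in (0 : ℝ)..T, (Real.log (2 * Real.pi) - 2 * Real.eulerMascheroniConstant) =
      (Real.log (2 * Real.pi) - 2 * Real.eulerMascheroniConstant) * T := by
    rw [intervalIntegral.integral_const, smul_eq_mul]
    ring
  rw [← h1, ← intervalIntegral.integral_sub intervalIntegrable_const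
    (intervalIntegrable_zetaSqExcess 0 T), logHardyLittlewoodIntegral]
  congr 1
  funext t
  rw [zetaSqExcess, criticalPoint]
  ring

theorem lemma3 :
    (∀ T : ℝ, 0 < T →
      IntervalIntegrable
        (fun t : ℝ => Real.log t - ‖riemannZeta (1 / 2 + (t : ℂ) * Complex.I)‖ ^ 2)
        MeasureTheory.volume 0 T) ∧
    (∀ x : ℝ, 0 < x →
      Filter.Tendsto
        (fun τ : ℝ => (1 / τ) * logHardyLittlewoodIntegral
          (x * τ / (Real.log (2 * Real.pi) - 2 * Real.eulerMascheroniConstant)))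
        Filter.atTop (nhds x)) ∧
    Asymptotics.IsEquivalent Filter.atTop
      logHardyLittlewoodIntegral
      (fun T : ℝ => (Real.log (2 * Real.pi) - 2 * Real.eulerMascheroniConstant) * T) := by
  set c := Real.log (2 * Real.pi) - 2 * Real.eulerMascheroniConstant with hc
  have hc0 : 0 < c := log_two_pi_sub_two_mul_euler_pos
  have hequiv : Asymptotics.IsEquivalent atTop logHardyLittlewoodIntegral
      (fun T : ℝ => c * T) := by
    rw [Asymptotics.IsEquivalent]
    have h1 : logHardyLittlewoodIntegral - (fun T : ℝ => c * T) =
        fun T => -∫ t in (0 : ℝ)..T, zetaSqExcess t := by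
      funext T
      simp only [Pi.sub_apply]
      rw [logHardyLittlewoodIntegral_eq]
      ring
    rw [h1]
    exact (Asymptotics.isLittleO_const_mul_right_iff hc0.ne').mpr
      isLittleO_integral_zetaSqExcess.neg_left
  refine ⟨fun T _ => ?_, fun x hx => ?_, hequiv⟩
  · have h1 := (intervalIntegrable_const (c := c)).sub (intervalIntegrable_zetaSqExcess 0 T)
    refine h1.congr fun t _ => ?_
    rw [zetaSqExcess, criticalPoint]
    ring
  · have h1 : Tendsto (logHardyLittlewoodIntegral / fun T : ℝ => c * T) atTop (𝓝 1) :=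
      (Asymptotics.isEquivalent_iff_tendsto_one (by
        filter_upwards [eventually_gt_atTop 0] with T hT
        positivity)).mp hequiv
    have h2 : Tendsto (fun τ : ℝ => x * τ / c) atTop atTop :=
      (tendsto_id.const_mul_atTop hx).atTop_div_const hc0
    have h3 := (h1.comp h2).const_mul x
    rw [mul_one] at h3
    refine h3.congr' ?_
    filter_upwards [eventually_gt_atTop 0] with τ hτ
    simp only [Function.comp, Pi.div_apply]
    field_simp

end
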